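/- Let $k$ be a field and $n\ge 1$. Let $k[x]$ be the polynomial ring in $x=(x_1,\dots,x_n)$, $k[x]_{(x)}$ its localization at the origin (fractions $p/q$ with $q(0)\neq0$), $k[[x]]$ the ring of formal power series and, for $k=\mathbb C$, $\mathbb C\{x\}$ the ring of convergent power series; all are regarded as subrings of $k[[x]]$. Let $D\subset D_{alg}\subset\hat D$ be the rings of differential operators with coefficients in $k[x]$, $k[x]_{(x)}$, $k[[x]]$, and for $k=\mathbb C$ let $D_0$ be the one with coefficients in $\mathbb C\{x\}$: their elements are the finite sums $\sum_\beta c_\beta\partial^\beta$, the $\partial_i$ commute, and $\partial_i c-c\,\partial_i=\partial c/\partial x_i$. Ideals of these rings, and of their graded rings, are left ideals. Let $U_{loc}=\{u\in\mathbb R^n: u_i\le 0\ \forall i\}$ and $W_{loc}=\{w=(u,v)\in\mathbb R^{2n}: u_i\le 0,\ u_i+v_i\ge 0\ \forall i\}$. For $u\in U_{loc}$ the order $\mathrm{ord}^u(f)$ of a power series $f\ne0$ is the maximum of $u\cdot\alpha$ over the monomials $x^\alpha$ occurring in $f$; for $w=(u,v)\in W_{loc}$ the order $\mathrm{ord}^w(P)$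 of an operator $P\neq 0$ is the maximum of $u\cdot\alpha+v\cdot\beta$ over the monomials $x^\alpha\partial^\beta$ occurring in $P$; the order of $0$ is $-\infty$. For a ring $R$ as above and $w$ in $U_{loc}$ (resp. $W_{loc}$ when $R$ is a ring of operators), put $F^w_t=\{f\in R:\mathrm{ord}^w(f)\le t\}$, $F^w_{<t}=\{f\in R:\mathrm{ord}^w(f)<t\}$ and $\mathrm{gr}^w(R)=\bigoplus_{t\in\mathbb R}F^w_t/F^w_{<t}$. The initial form $\mathrm{in}_w(f)$ of $f\ne 0$ is its class in $F^w_t/F^w_{<t}$, $t=\mathrm{ord}^w(f)$, and for an ideal $I\subset R$, $\mathrm{in}_w(I)\subset\mathrm{gr}^w(R)$ is the ideal generated by all $\mathrm{in}_w(f)$, $0\ne f\in I$. For $R\subset R'$ and an ideal $I\subset R$, $R'I$ denotes the ideal of $R'$ generated by $I$, and $\mathrm{gr}^w(R')\,\mathrm{in}_w(I)$ the ideal of $\mathrm{gr}^w(R')$ generated by the image of $\mathrm{in}_w(I)$ under the canonical map $\mathrm{gr}^w(R)\to\mathrm{gr}^w(R')$. Theorem. Let $u\in U_{loc}$ and $w\in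 W_{loc}$. (i) For every ideal $I\subset k[x]$: $\mathrm{gr}^u(k[x]_{(x)})\,\mathrm{in}_u(I)=\mathrm{in}_u(k[x]_{(x)}I)$. (ii) For every ideal $I\subset k[x]_{(x)}$: $\mathrm{gr}^u(k[[x]])\,\mathrm{in}_u(I)=\mathrm{in}_u(k[[x]]I)$. (iii) For $k=\mathbb C$: $\mathrm{gr}^u(\mathbb C\{x\})\,\mathrm{in}_u(I)=\mathrm{in}_u(\mathbb C\{x\}I)$ for every ideal $I\subset \mathbb C[x]_{(x)}$, and $\mathrm{gr}^u(\mathbb C[[x]])\,\mathrm{in}_u(I)=\mathrm{in}_u(\mathbb C[[x]]I)$ for every ideal $I\subset\mathbb C\{x\}$. (1) For every ideal $I\subset D$: $\mathrm{gr}^w(D_{alg})\,\mathrm{in}_w(I)=\mathrm{in}_w(D_{alg}I)$. (2) For every ideal $I\subset D_{alg}$: $\mathrm{gr}^w(\hat D)\,\mathrm{in}_w(I)=\mathrm{in}_w(\hat DI)$. (3) For $k=\mathbb C$: $\mathrm{gr}^w(D_0)\,\mathrm{in}_w(I)=\mathrm{in}_w(D_0I)$ for every ideal $I\subset D_{alg}$,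 and $\mathrm{gr}^w(\hat D)\,\mathrm{in}_w(I)=\mathrm{in}_w(\hat DI)$ for every ideal $I\subset D_0$. Moreover, identify elements of graded rings of $R$ for different weights when they have the same coefficients (the coefficients of a class in $F^w_t/F^w_{<t}$ being those of a representative at the monomials of weight $t$). Let the stratum $S_R(w)$ be the set of weights $w'$ in $U_{loc}$ (resp. $W_{loc}$) for which $\mathrm{gr}^{w'}(R)=\mathrm{gr}^w(R)$ as rings under this identification, let the Gröbner cone $C_I[w]$ of an ideal $I\subset R$ be the set of $w'\in S_R(w)$ with $\mathrm{in}_{w'}(I)=\mathrm{in}_w(I)$, and let the open Gröbner fan of $I$ be the set of its Gröbner cones. Then for every ideal $I\subset k[x]$ (resp. $I\subset D$) the open Gröbner fan of $I$ on $U_{loc}$ (resp. $W_{loc}$) refines, up to the stratification by the local ring $R'=k[x]_{(x)}$ (resp. $R'=D_{alg}$), the open Gröbner fan of $R'I$: for every cone $C$ of the first and every stratum $S$ of $R'$, $C\cap S$ is empty or contained in a cone of the second. -/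

import Mathlib

namespace GrobnerComparison

/-- A ring `A` whose elements are determined by coefficients in `k` indexed by a set `ι` of
monomials, with a real weight on every monomial such that the monomials of a product `f * g` have
weight at most the sum of the weights of some monomial of `f` and some monomial of `g`. -/
structure Weighting (A ι k : Type*) [Ring A] [Field k] where
  coeff : A →+ (ι → k)
  coeff_injective : Function.Injective coeff
  wt : ι → ℝ
  one_le : ∀ i, coeff 1 i ≠ 0 → wt i ≤ 0
  mul_le : ∀ f g i, coeff (f * g) i ≠ 0 →
    ∃ j l, coeff f j ≠ 0 ∧ coeff g l ≠ 0 ∧ wt i ≤ wt j + wt l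

namespace Weighting

variable {A ι k : Type*} [Ring A] [Field k]

/-- The weighting induced on a subring. -/
def restrict (F : Weighting A ι k) (R : Subring A) : Weighting R ι k where
  coeff := F.coeff.comp R.subtype.toAddMonoidHom
  coeff_injective := F.coeff_injective.comp Subtype.val_injective
  wt := F.wt
  one_le := F.one_le
  mul_le f g := F.mul_le f g

/-- `F_t`: the elements of order at most `t`. -/
def le (F : Weighting A ι k) (t : ℝ) : AddSubgroup A where
  carrier := {f | ∀ i, F.coeff f i ≠ 0 → F.wt i ≤ t}
  zero_mem' i h := by simp at h
  add_mem' {f g} hf hg i h := by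
    by_contra hc
    have h1 : F.coeff f i = 0 := by by_contra h0; exact hc (hf i h0)
    have h2 : F.coeff g i = 0 := by by_contra h0; exact hc (hg i h0)
    simp [h1, h2] at h
  neg_mem' {f} hf i h := hf i (by simpa using h)

/-- `F_{<t}`: the elements of order less than `t`, the order of `f` being the maximum (when it
exists) of the weights of the monomials of `f`. -/
def lt (F : Weighting A ι k) (t : ℝ) : AddSubgroup A where
  carrier := {f | ∀ i, F.coeff f i ≠ 0 → F.wt i < t}
  zero_mem' i h := by simp at h
  add_mem' {f g} hf hg i h := by
    by_contra hc
    have h1 : F.coeff f i = 0 := by by_contra h0; exact hc (hf i h0)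
    have h2 : F.coeff g i = 0 := by by_contra h0; exact hc (hg i h0)
    simp [h1, h2] at h
  neg_mem' {f} hf i h := hf i (by simpa using h)

variable (F : Weighting A ι k)

theorem one_mem_le : (1 : A) ∈ F.le 0 := F.one_le

theorem mul_mem_le {s t : ℝ} {f g : A} (hf : f ∈ F.le s) (hg : g ∈ F.le t) :
    f * g ∈ F.le (s + t) := fun i h => by
  obtain ⟨j, l, hj, hl, hw⟩ := F.mul_le f g i h
  have := hf j hj
  have := hg l hl
  linarith

theorem mul_mem_lt_left {s t : ℝ} {f g : A} (hf : f ∈ F.lt s) (hg : g ∈ F.le t) :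
    f * g ∈ F.lt (s + t) := fun i h => by
  obtain ⟨j, l, hj, hl, hw⟩ := F.mul_le f g i h
  have := hf j hj
  have := hg l hl
  linarith

theorem mul_mem_lt_right {s t : ℝ} {f g : A} (hf : f ∈ F.le s) (hg : g ∈ F.lt t) :
    f * g ∈ F.lt (s + t) := fun i h => by
  obtain ⟨j, l, hj, hl, hw⟩ := F.mul_le f g i h
  have := hf j hj
  have := hg l hl
  linarith

/-- The piece `F_t / F_{<t}` of degree `t` of the associated graded ring. -/
abbrev GrPiece (t : ℝ) : Type _ := F.le t ⧸ (F.lt t).addSubgroupOf (F.le t)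

/-- The class in `F_t / F_{<t}` of an element of `F_t`. -/
def piece (t : ℝ) : F.le t →+ F.GrPiece t :=
  QuotientAddGroup.mk' ((F.lt t).addSubgroupOf (F.le t))

theorem piece_surjective (t : ℝ) : Function.Surjective (F.piece t) :=
  QuotientAddGroup.mk'_surjective _

theorem piece_eq_zero {t : ℝ} (f : F.le t) : F.piece t f = 0 ↔ (f : A) ∈ F.lt t := by
  rw [piece, QuotientAddGroup.mk'_apply, QuotientAddGroup.eq_zero_iff,
    AddSubgroup.mem_addSubgroupOf]

/-- Multiplication of representatives. -/
def preMul (s t : ℝ) : F.le s →+ F.le t →+ F.le (s + t) :=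
  AddMonoidHom.mk' (fun f => AddMonoidHom.mk' (fun g => ⟨f * g, F.mul_mem_le f.2 g.2⟩)
    fun g g' => Subtype.ext (mul_add (f : A) g g'))
    fun f f' => AddMonoidHom.ext fun g => Subtype.ext (add_mul (f : A) f' g)

/-- The multiplication `F_s / F_{<s} × F_t / F_{<t} → F_{s+t} / F_{<s+t}`. -/
def pieceMul (s t : ℝ) : F.GrPiece s →+ F.GrPiece t →+ F.GrPiece (s + t) :=
  QuotientAddGroup.lift _
    (AddMonoidHom.mk' (fun f => QuotientAddGroup.lift _
      ((F.piece (s + t)).comp (F.preMul s t f))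
      (fun _ hg => (F.piece_eq_zero _).2
        (F.mul_mem_lt_right f.2 (AddSubgroup.mem_addSubgroupOf.1 hg))))
      fun f f' => by
        ext g
        simp only [map_add]
        rfl)
    (fun _ hf => by
      ext g
      exact (F.piece_eq_zero _).2 (F.mul_mem_lt_left (AddSubgroup.mem_addSubgroupOf.1 hf) g.2))

theorem pieceMul_piece {s t : ℝ} (f : F.le s) (g : F.le t) :
    F.pieceMul s t (F.piece s f) (F.piece t g) =
      F.piece (s + t) ⟨f * g, F.mul_mem_le f.2 g.2⟩ := rfl

theorem mk_piece_congr {s t : ℝ} (h : s = t) (f : F.le s) (g : F.le t) (hfg : (f : A) = g) :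
    (GradedMonoid.mk s (F.piece s f) : GradedMonoid F.GrPiece) =
      GradedMonoid.mk t (F.piece t g) := by
  subst h
  rw [Subtype.ext hfg]

instance : GradedMonoid.GOne F.GrPiece where
  one := F.piece 0 ⟨1, F.one_mem_le⟩

instance : GradedMonoid.GMul F.GrPiece where
  mul a b := F.pieceMul _ _ a b

instance : DirectSum.GRing F.GrPiece where
  mul_zero _ := map_zero _
  zero_mul {i j} b := DFunLike.congr_fun ((F.pieceMul i j).map_zero) b
  mul_add _ _ _ := map_add _ _ _
  add_mul {i j} a b c := DFunLike.congr_fun ((F.pieceMul i j).map_add a b) c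
  one_mul := by
    rintro ⟨t, a⟩
    obtain ⟨f, rfl⟩ := F.piece_surjective t a
    exact F.mk_piece_congr (zero_add t) _ _ (one_mul (f : A))
  mul_one := by
    rintro ⟨t, a⟩
    obtain ⟨f, rfl⟩ := F.piece_surjective t a
    exact F.mk_piece_congr (add_zero t) _ _ (mul_one (f : A))
  mul_assoc := by
    rintro ⟨r, a⟩ ⟨s, b⟩ ⟨t, c⟩
    obtain ⟨f, rfl⟩ := F.piece_surjective r a
    obtain ⟨g, rfl⟩ := F.piece_surjective s b
    obtain ⟨h, rfl⟩ := F.piece_surjective t c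
    exact F.mk_piece_congr (add_assoc r s t) _ _ (mul_assoc (f : A) g h)
  natCast m := m • F.piece 0 ⟨1, F.one_mem_le⟩
  natCast_zero := zero_nsmul _
  natCast_succ m := succ_nsmul _ m
  intCast m := m • F.piece 0 ⟨1, F.one_mem_le⟩
  intCast_ofNat m := natCast_zsmul _ m
  intCast_negSucc_ofNat m := negSucc_zsmul _ m

/-- The associated graded ring `⨁ t, F_t / F_{<t}`. -/
abbrev Gr : Type _ := DirectSum ℝ F.GrPiece

/-- The class in `F_t / F_{<t}` of an element of `F_t`, as an element of the graded ring. -/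
noncomputable def symbol (t : ℝ) : F.le t →+ F.Gr := (DirectSum.of F.GrPiece t).comp (F.piece t)

/-- The initial forms of the elements of a set `I`: the class of `f` in `F_t / F_{<t}` for
`f ∈ I` of order exactly `t`. -/
def initialForms (I : Set A) : Set F.Gr :=
  {s | ∃ (t : ℝ) (f : F.le t), (f : A) ∈ I ∧ (f : A) ∉ F.lt t ∧ s = F.symbol t f}

/-- The initial ideal of a (left) ideal: the (left) ideal generated by the initial forms of the
elements of the ideal. -/
noncomputable def initialIdeal (I : Ideal A) : Ideal F.Gr := Ideal.span (F.initialForms I)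

/-- The coefficients of an element of the graded ring; on the piece of degree `t` these are the
coefficients, at the monomials of weight `t`, of any representative. -/
noncomputable def grCoeff : F.Gr →+ (ι → k) :=
  DirectSum.toAddMonoid fun t => QuotientAddGroup.lift _
    (AddMonoidHom.mk' (fun f : F.le t => {i | F.wt i = t}.indicator (F.coeff f))
      fun f g => by simp [Set.indicator_add'])
    fun f hf => by
      ext i
      by_contra h
      simp only [AddMonoidHom.mk'_apply, Pi.zero_apply, Set.indicator_apply_eq_zero,
        Set.mem_ofPred_eq, not_forall] at h
      exact (AddSubgroup.mem_addSubgroupOf.1 hf i h.2).ne h.1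

theorem grCoeff_symbol (t : ℝ) (f : F.le t) :
    F.grCoeff (F.symbol t f) = {i | F.wt i = t}.indicator (F.coeff f) := by
  simp only [grCoeff, symbol, AddMonoidHom.comp_apply, DirectSum.toAddMonoid_of]
  rfl

section inclusion

variable {R R' : Subring A} (h : R ≤ R')

/-- The map `F_t / F_{<t}` of a subring to that of a bigger subring. -/
def pieceInclusion (t : ℝ) : (F.restrict R).GrPiece t →+ (F.restrict R').GrPiece t :=
  QuotientAddGroup.map _ _
    (AddMonoidHom.mk' (fun f : (F.restrict R).le t =>
      (⟨Subring.inclusion h f, f.2⟩ : (F.restrict R').le t)) fun _ _ => rfl)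
    fun _ hf => hf

/-- The canonical homomorphism from the graded ring of a subring to that of a bigger subring. -/
noncomputable def grInclusion : (F.restrict R).Gr →+* (F.restrict R').Gr :=
  DirectSum.toSemiring (fun t => (DirectSum.of _ t).comp (F.pieceInclusion h t))
    rfl
    (fun {s t} a b => by
      obtain ⟨f, rfl⟩ := (F.restrict R).piece_surjective s a
      obtain ⟨g, rfl⟩ := (F.restrict R).piece_surjective t b
      simp only [AddMonoidHom.comp_apply, DirectSum.of_mul_of]
      rfl)

theorem grInclusion_symbol (t : ℝ) (f : (F.restrict R).le t) :
    F.grInclusion h ((F.restrict R).symbol t f) =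
      (F.restrict R').symbol t ⟨Subring.inclusion h f, f.2⟩ := by
  exact DirectSum.toAddMonoid_of _ _ _

end inclusion

end Weighting

section fan

variable {A ι k W : Type*} [Ring A] [Field k] (F : W → Weighting A ι k) (R : Subring A)

/-- `S_R(w)`: the weights with the same graded ring as `w`, elements of graded rings
being identified when they have the same coefficients. -/
def stratum (w : W) : Set W :=
  {w' | ∃ e : ((F w).restrict R).Gr ≃+* ((F w').restrict R).Gr,
    ∀ s, ((F w').restrict R).grCoeff (e s) = ((F w).restrict R).grCoeff s}

/-- The Gröbner cone `C_I[w]`: the weights with the same graded ring and the same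
initial ideal of `I` as `w`. -/
def groebnerCone (I : Ideal R) (w : W) : Set W :=
  {w' | w' ∈ stratum F R w ∧
    ((F w').restrict R).grCoeff '' (((F w').restrict R).initialIdeal I) =
      ((F w).restrict R).grCoeff '' (((F w).restrict R).initialIdeal I)}

/-- The open Gröbner fan: the set of the Gröbner cones. -/
def groebnerFan (I : Ideal R) : Set (Set W) := Set.range (groebnerCone F R I)

end fan
section power_series

variable {k : Type*} [Field k] {n : ℕ}

/-- `k[x]`, as a subring of `k[[x]]`. -/
noncomputable def polynomialRing (k : Type*) [Field k] (n : ℕ) : Subring (MvPowerSeries (Fin n) k) :=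
  (MvPolynomial.coeToMvPowerSeries.ringHom (σ := Fin n) (R := k)).range

/-- The localization of `k[x]` at the origin, as a subring of `k[[x]]`: the fractions `p / q` of
polynomials with `q(0) ≠ 0`. -/
def localRing (k : Type*) [Field k] (n : ℕ) : Subring (MvPowerSeries (Fin n) k) where
  carrier := {f | ∃ p q : MvPolynomial (Fin n) k,
    MvPolynomial.constantCoeff q ≠ 0 ∧ f * (q : MvPowerSeries (Fin n) k) = p}
  zero_mem' := ⟨0, 1, by simp, by simp⟩
  one_mem' := ⟨1, 1, by simp, by simp⟩
  add_mem' := by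
    rintro f g ⟨p, q, hq, h⟩ ⟨p', q', hq', h'⟩
    refine ⟨p * q' + p' * q, q * q', by simp [hq, hq'], ?_⟩
    push_cast
    rw [← h, ← h']
    ring
  mul_mem' := by
    rintro f g ⟨p, q, hq, h⟩ ⟨p', q', hq', h'⟩
    refine ⟨p * p', q * q', by simp [hq, hq'], ?_⟩
    push_cast
    rw [← h, ← h']
    ring
  neg_mem' := by
    rintro f ⟨p, q, hq, h⟩
    refine ⟨-p, q, hq, ?_⟩
    rw [neg_mul, h, ← MvPolynomial.coeToMvPowerSeries.ringHom_apply,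
      ← MvPolynomial.coeToMvPowerSeries.ringHom_apply, map_neg]

/-- A formal power series over `ℂ` is convergent if it converges absolutely at `(r, …, r)` for
some `r > 0`. -/
def IsConvergent (f : MvPowerSeries (Fin n) ℂ) : Prop :=
  ∃ r : ℝ, 0 < r ∧
    Summable fun α : Fin n →₀ ℕ => ‖MvPowerSeries.coeff α f‖ * r ^ α.degree

theorem summable_of_le {f : MvPowerSeries (Fin n) ℂ} {r s : ℝ} (hr : 0 < r) (hrs : r ≤ s)
    (h : Summable fun α : Fin n →₀ ℕ => ‖MvPowerSeries.coeff α f‖ * s ^ α.degree) :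
    Summable fun α : Fin n →₀ ℕ => ‖MvPowerSeries.coeff α f‖ * r ^ α.degree :=
  h.of_nonneg_of_le (fun _ => by positivity) fun _ => by gcongr

theorem isConvergent_coe (p : MvPolynomial (Fin n) ℂ) :
    IsConvergent (p : MvPowerSeries (Fin n) ℂ) := by
  refine ⟨1, one_pos, summable_of_ne_finset_zero (s := p.support) fun α hα => ?_⟩
  simp [MvPolynomial.coeff_coe, MvPolynomial.notMem_support_iff.1 hα]

theorem isConvergent_mul {f g : MvPowerSeries (Fin n) ℂ} (hf : IsConvergent f)
    (hg : IsConvergent g) : IsConvergent (f * g) := by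
  classical
  obtain ⟨r, hr, hf⟩ := hf
  obtain ⟨s, hs, hg⟩ := hg
  have hm : 0 < min r s := lt_min hr hs
  have hf' := summable_of_le hm (min_le_left _ _) hf
  have hg' := summable_of_le hm (min_le_right _ _) hg
  obtain ⟨F, hF⟩ : ∃ F : (Fin n →₀ ℕ) → ℝ,
      F = fun α => ‖MvPowerSeries.coeff α f‖ * min r s ^ α.degree := ⟨_, rfl⟩
  obtain ⟨G, hG⟩ : ∃ G : (Fin n →₀ ℕ) → ℝ,
      G = fun α => ‖MvPowerSeries.coeff α g‖ * min r s ^ α.degree := ⟨_, rfl⟩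
  rw [← hF] at hf'
  rw [← hG] at hg'
  have hF0 : 0 ≤ F := fun α => by rw [hF]; positivity
  have hG0 : 0 ≤ G := fun α => by rw [hG]; positivity
  have hsum := summable_sum_mul_antidiagonal_of_summable_mul (f := F) (g := G)
    (Summable.mul_of_nonneg hf' hg' hF0 hG0)
  refine ⟨min r s, hm, Summable.of_nonneg_of_le (fun α => by positivity) (fun α => ?_) hsum⟩
  rw [MvPowerSeries.coeff_mul]
  refine (mul_le_mul_of_nonneg_right (norm_sum_le _ _) (by positivity)).trans ?_
  rw [Finset.sum_mul]
  refine Finset.sum_le_sum fun p hp => le_of_eq ?_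
  rw [← Finset.HasAntidiagonal.mem_antidiagonal.1 hp, map_add, pow_add, norm_mul, hF, hG]
  ring

/-- The ring `ℂ{x}` of convergent power series (germs of analytic functions at the origin). -/
def analyticRing (n : ℕ) : Subring (MvPowerSeries (Fin n) ℂ) where
  carrier := {f | IsConvergent f}
  zero_mem' := ⟨1, one_pos, by simp⟩
  one_mem' := by simpa using isConvergent_coe (n := n) 1
  add_mem' := by
    rintro f g ⟨r, hr, hf⟩ ⟨s, hs, hg⟩
    have hm : 0 < min r s := lt_min hr hs
    refine ⟨min r s, hm, ((summable_of_le hm (min_le_left _ _) hf).add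
      (summable_of_le hm (min_le_right _ _) hg)).of_nonneg_of_le (fun _ => by positivity)
      fun α => ?_⟩
    rw [← add_mul, map_add]
    gcongr
    exact norm_add_le _ _
  mul_mem' := isConvergent_mul
  neg_mem' := by
    rintro f ⟨r, hr, hf⟩
    exact ⟨r, hr, by simpa using hf⟩

theorem polynomialRing_le_localRing : polynomialRing k n ≤ localRing k n := by
  rintro _ ⟨p, rfl⟩
  exact ⟨p, 1, by simp, by simp⟩

theorem localRing_le_analyticRing : localRing ℂ n ≤ analyticRing n := by
  classical
  rintro f ⟨p, q, hq, h⟩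
  set c := MvPolynomial.constantCoeff q with hc
  set g : MvPolynomial (Fin n) ℂ := 1 - MvPolynomial.C c⁻¹ * q with hg
  set p' : MvPolynomial (Fin n) ℂ := MvPolynomial.C c⁻¹ * p with hp'
  have hfg : f = (p' : MvPowerSeries (Fin n) ℂ) + g * f := by
    have h1 : ((MvPolynomial.C c⁻¹ * q + g : MvPolynomial (Fin n) ℂ) :
        MvPowerSeries (Fin n) ℂ) = 1 := by simp [hg]
    push_cast at h1
    rw [hp']
    push_cast
    linear_combination (-f) * h1 + (MvPowerSeries.C c⁻¹) * h
  have hg0 : MvPolynomial.coeff 0 g = 0 := by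
    rw [← MvPolynomial.constantCoeff_eq, hg]
    simp [← hc, hq]
  obtain ⟨B, hB⟩ : ∃ B : ℝ, ∑ α ∈ g.support, ‖MvPolynomial.coeff α g‖ = B := ⟨_, rfl⟩
  have hB0 : 0 ≤ B := hB ▸ Finset.sum_nonneg fun _ _ => norm_nonneg _
  obtain ⟨r, hr, hr1, hrB⟩ : ∃ r : ℝ, 0 < r ∧ r ≤ 1 ∧ r * B ≤ 1 / 2 := by
    refine ⟨1 / (2 * (1 + B)), by positivity, ?_, ?_⟩
    · rw [div_le_one (by positivity)]; linarith
    · rw [div_mul_eq_mul_div, div_le_div_iff₀ (by positivity) two_pos]; linarith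
  have hgB : ∀ s : Finset (Fin n →₀ ℕ), ∑ α ∈ s, ‖MvPolynomial.coeff α g‖ * r ^ α.degree ≤ 1 / 2 := by
    intro s
    refine le_trans ?_ hrB
    rw [← hB, Finset.mul_sum]
    calc ∑ α ∈ s, ‖MvPolynomial.coeff α g‖ * r ^ α.degree
        ≤ ∑ α ∈ s ∪ g.support, ‖MvPolynomial.coeff α g‖ * r ^ α.degree :=
          Finset.sum_le_sum_of_subset_of_nonneg Finset.subset_union_left
            fun _ _ _ => by positivity
      _ = ∑ α ∈ g.support, ‖MvPolynomial.coeff α g‖ * r ^ α.degree := by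
          refine (Finset.sum_subset Finset.subset_union_right fun α _ hα => ?_).symm
          simp [MvPolynomial.notMem_support_iff.1 hα]
      _ ≤ _ := by
          refine Finset.sum_le_sum fun α hα => ?_
          rw [mul_comm]
          refine mul_le_mul_of_nonneg_right ?_ (norm_nonneg _)
          refine pow_le_of_le_one hr.le hr1 fun h0 => ?_
          rw [Finsupp.degree_eq_zero_iff] at h0
          subst h0
          exact MvPolynomial.mem_support_iff.1 hα hg0
  have hp : Summable fun α : Fin n →₀ ℕ => ‖MvPolynomial.coeff α p'‖ * r ^ α.degree :=
    summable_of_ne_finset_zero (s := p'.support) fun α hα => by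
      simp [MvPolynomial.notMem_support_iff.1 hα]
  have key : ∀ γ : Fin n →₀ ℕ, ∑ α ∈ Finset.Iic γ, ‖MvPowerSeries.coeff α f‖ * r ^ α.degree ≤
      2 * ∑' α : Fin n →₀ ℕ, ‖MvPolynomial.coeff α p'‖ * r ^ α.degree := by
    intro γ
    set S := ∑ α ∈ Finset.Iic γ, ‖MvPowerSeries.coeff α f‖ * r ^ α.degree with hS
    have hS0 : 0 ≤ S := Finset.sum_nonneg fun _ _ => by positivity
    have h1 : S ≤ ∑ α ∈ Finset.Iic γ, ‖MvPolynomial.coeff α p'‖ * r ^ α.degree +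
        ∑ α ∈ Finset.Iic γ, ∑ x ∈ Finset.HasAntidiagonal.antidiagonal α,
          (‖MvPolynomial.coeff x.1 g‖ * r ^ x.1.degree) *
            (‖MvPowerSeries.coeff x.2 f‖ * r ^ x.2.degree) := by
      rw [← Finset.sum_add_distrib, hS]
      refine Finset.sum_le_sum fun α _ => ?_
      conv_lhs => rw [hfg, map_add, MvPolynomial.coeff_coe, MvPowerSeries.coeff_mul]
      refine (mul_le_mul_of_nonneg_right (norm_add_le _ _) (by positivity)).trans ?_
      rw [add_mul]
      gcongr
      refine (mul_le_mul_of_nonneg_right (norm_sum_le _ _) (by positivity)).trans ?_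
      rw [Finset.sum_mul]
      refine Finset.sum_le_sum fun x hx => le_of_eq ?_
      rw [← Finset.HasAntidiagonal.mem_antidiagonal.1 hx, map_add, pow_add, norm_mul, MvPolynomial.coeff_coe]
      ring
    have h2 : ∑ α ∈ Finset.Iic γ, ∑ x ∈ Finset.HasAntidiagonal.antidiagonal α,
          (‖MvPolynomial.coeff x.1 g‖ * r ^ x.1.degree) *
            (‖MvPowerSeries.coeff x.2 f‖ * r ^ x.2.degree) ≤
        (∑ α ∈ Finset.Iic γ, ‖MvPolynomial.coeff α g‖ * r ^ α.degree) * S := by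
      rw [hS, Finset.sum_mul_sum, ← Finset.sum_product', ← Finset.sum_biUnion]
      · refine Finset.sum_le_sum_of_subset_of_nonneg (fun x hx => ?_) fun _ _ _ => by positivity
        obtain ⟨α, hα, hx⟩ := Finset.mem_biUnion.1 hx
        rw [← Finset.HasAntidiagonal.mem_antidiagonal.1 hx, Finset.mem_Iic] at hα
        exact Finset.mem_product.2 ⟨Finset.mem_Iic.2 (le_self_add.trans hα),
          Finset.mem_Iic.2 (le_add_self.trans hα)⟩
      · intro α _ β _ hne
        refine Finset.disjoint_left.2 fun x hx hx' => hne ?_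
        rw [← Finset.HasAntidiagonal.mem_antidiagonal.1 hx,
          Finset.HasAntidiagonal.mem_antidiagonal.1 hx']
    have h3 := mul_le_mul_of_nonneg_right (hgB (Finset.Iic γ)) hS0
    have h4 := hp.sum_le_tsum (Finset.Iic γ) fun _ _ => by positivity
    linarith
  refine ⟨r, hr, summable_of_sum_le
    (c := 2 * ∑' α : Fin n →₀ ℕ, ‖MvPolynomial.coeff α p'‖ * r ^ α.degree)
    (fun _ => by positivity) fun s => le_trans ?_ (key (s.sup id))⟩
  exact Finset.sum_le_sum_of_subset_of_nonneg
    (fun α hα => Finset.mem_Iic.2 (Finset.le_sup (f := id) hα)) fun _ _ _ => by positivity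

theorem pderiv_mem_polynomialRing (i : Fin n) {f : MvPowerSeries (Fin n) k}
    (hf : f ∈ polynomialRing k n) : MvPowerSeries.pderiv k i f ∈ polynomialRing k n := by
  obtain ⟨p, rfl⟩ := hf
  exact ⟨MvPolynomial.pderiv i p, (MvPowerSeries.pderiv_coe _).symm⟩

theorem pderiv_mem_localRing (i : Fin n) {f : MvPowerSeries (Fin n) k}
    (hf : f ∈ localRing k n) : MvPowerSeries.pderiv k i f ∈ localRing k n := by
  obtain ⟨p, q, hq, h⟩ := hf
  refine ⟨MvPolynomial.pderiv i p * q - p * MvPolynomial.pderiv i q, q * q, by simp [hq], ?_⟩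
  have h1 := congrArg (MvPowerSeries.pderiv k i) h
  rw [Derivation.leibniz, MvPowerSeries.pderiv_coe, MvPowerSeries.pderiv_coe, smul_eq_mul,
    smul_eq_mul] at h1
  rw [← MvPolynomial.coeToMvPowerSeries.ringHom_apply (MvPolynomial.pderiv i p * q - _), map_sub]
  simp only [MvPolynomial.coeToMvPowerSeries.ringHom_apply]
  push_cast
  rw [← h1, ← h]
  ring

theorem pderiv_mem_analyticRing (i : Fin n) {f : MvPowerSeries (Fin n) ℂ}
    (hf : f ∈ analyticRing n) : MvPowerSeries.pderiv ℂ i f ∈ analyticRing n := by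
  obtain ⟨r, hr, h⟩ := hf
  refine ⟨r / 2, by positivity, ?_⟩
  have h1 := (h.comp_injective (add_left_injective (Finsupp.single i 1))).mul_left r⁻¹
  refine h1.of_nonneg_of_le (fun _ => by positivity) fun α => ?_
  rw [MvPowerSeries.coeff_pderiv, Function.comp_apply, map_add, Finsupp.degree_single, norm_mul,
    pow_succ, div_pow]
  have h2 : ‖((α i : ℂ) + 1)‖ ≤ 2 ^ α.degree := by
    have h3 : ‖((α i : ℂ) + 1)‖ = ((α i + 1 : ℕ) : ℝ) := by
      rw [← Complex.norm_natCast]; push_cast; rfl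
    rw [h3]
    have h4 : α i + 1 ≤ 2 ^ α i := Nat.lt_two_pow_self
    have h5 : 2 ^ α i ≤ 2 ^ α.degree := Nat.pow_le_pow_right two_pos (Finsupp.le_degree i α)
    exact_mod_cast h4.trans h5
  calc _ ≤ ‖MvPowerSeries.coeff (α + Finsupp.single i 1) f‖ * 2 ^ α.degree *
        (r ^ α.degree / 2 ^ α.degree) := by gcongr
    _ = _ := by field_simp

/-- The pairing `u · α`. -/
noncomputable def pairing (u : Fin n → ℝ) (α : Fin n →₀ ℕ) : ℝ := ∑ i, u i * α i

theorem pairing_add (u : Fin n → ℝ) (α β : Fin n →₀ ℕ) :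
    pairing u (α + β) = pairing u α + pairing u β := by
  simp [pairing, mul_add, Finset.sum_add_distrib]

/-- The weights `u` on `k[[x]]`: the monomial `x^α` has weight `u · α`. -/
noncomputable def seriesWeighting (k : Type*) [Field k] (u : Fin n → ℝ) :
    Weighting (MvPowerSeries (Fin n) k) (Fin n →₀ ℕ) k where
  coeff := AddMonoidHom.mk' (fun f α => MvPowerSeries.coeff α f) fun f g => by ext; simp
  coeff_injective f g h := MvPowerSeries.ext fun α => congrFun h α
  wt := pairing u
  one_le α h := by
    classical
    simp only [AddMonoidHom.mk'_apply, MvPowerSeries.coeff_one, ne_eq, ite_eq_right_iff,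
      one_ne_zero, imp_false, not_not] at h
    simp [h, pairing]
  mul_le f g α h := by
    classical
    simp only [AddMonoidHom.mk'_apply, MvPowerSeries.coeff_mul] at h
    obtain ⟨p, hp, h⟩ := Finset.exists_ne_zero_of_sum_ne_zero h
    exact ⟨p.1, p.2, left_ne_zero_of_mul h, right_ne_zero_of_mul h,
      (by rw [← Finset.HasAntidiagonal.mem_antidiagonal.1 hp, pairing_add])⟩

end power_series

section operators

variable {k : Type*} [Field k] {n : ℕ}

/-- The ring of differential operators with coefficients in `k[[x]]`. The element
`P : DiffOp k n` stands for `∑ β, P β ∂^β`. -/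
def DiffOp (k : Type*) [Field k] (n : ℕ) : Type _ :=
  (Fin n →₀ ℕ) →₀ MvPowerSeries (Fin n) k

namespace DiffOp

noncomputable instance : AddCommGroup (DiffOp k n) :=
  inferInstanceAs (AddCommGroup ((Fin n →₀ ℕ) →₀ MvPowerSeries (Fin n) k))

noncomputable instance : Module (MvPowerSeries (Fin n) k) (DiffOp k n) :=
  inferInstanceAs (Module (MvPowerSeries (Fin n) k) ((Fin n →₀ ℕ) →₀ MvPowerSeries (Fin n) k))

/-- The coefficient series of `∂^β`. -/
def coeffAt (P : DiffOp k n) (β : Fin n →₀ ℕ) : MvPowerSeries (Fin n) k :=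
  DFunLike.coe (F := (Fin n →₀ ℕ) →₀ MvPowerSeries (Fin n) k) P β

/-- The operator `c ∂^β`. -/
noncomputable def term (β : Fin n →₀ ℕ) : MvPowerSeries (Fin n) k →+ DiffOp k n :=
  Finsupp.singleAddHom β

theorem coeffAt_add (P Q : DiffOp k n) (β : Fin n →₀ ℕ) : (P + Q).coeffAt β = P.coeffAt β + Q.coeffAt β := rfl

theorem coeffAt_smul (c : MvPowerSeries (Fin n) k) (P : DiffOp k n) (β : Fin n →₀ ℕ) :
    (c • P).coeffAt β = c * P.coeffAt β := rfl

theorem smul_term (c d : MvPowerSeries (Fin n) k) (β : Fin n →₀ ℕ) :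
    c • term β d = term β (c * d) := Finsupp.smul_single _ _ _

theorem hom_ext {M : Type*} [AddMonoid M] {S T : DiffOp k n →+ M}
    (h : ∀ β c, S (term β c) = T (term β c)) : S = T := Finsupp.addHom_ext h

/-- Left multiplication by `∂_i`: `∂_i (c ∂^β) = c ∂^(β + e_i) + (∂c/∂x_i) ∂^β`. -/
noncomputable def partialMul (i : Fin n) : AddMonoid.End (DiffOp k n) :=
  (Finsupp.mapDomain.addMonoidHom (fun β => β + Finsupp.single i 1) :
      ((Fin n →₀ ℕ) →₀ MvPowerSeries (Fin n) k) →+ _) +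
    (Finsupp.mapRange.addMonoidHom (MvPowerSeries.pderiv k i).toLinearMap.toAddMonoidHom :
      ((Fin n →₀ ℕ) →₀ MvPowerSeries (Fin n) k) →+ _)

theorem partialMul_term (i : Fin n) (β : Fin n →₀ ℕ) (c : MvPowerSeries (Fin n) k) :
    partialMul i (term β c) =
      term (β + Finsupp.single i 1) c + term β (MvPowerSeries.pderiv k i c) := by
  refine congrArg₂ (fun P Q : DiffOp k n => P + Q) ?_ ?_
  · exact Finsupp.mapDomain_single
  · exact Finsupp.mapRange_single (hf := map_zero (MvPowerSeries.pderiv k i))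

theorem pderiv_comm (i j : Fin n) (c : MvPowerSeries (Fin n) k) :
    MvPowerSeries.pderiv k i (MvPowerSeries.pderiv k j c) =
      MvPowerSeries.pderiv k j (MvPowerSeries.pderiv k i c) := by
  ext α
  simp only [MvPowerSeries.coeff_pderiv]
  by_cases h : i = j
  · rw [h]
  · rw [add_right_comm]
    simp [h, Ne.symm h]
    ring

theorem partialMul_commute (i j : Fin n) :
    Commute (partialMul i : AddMonoid.End (DiffOp k n)) (partialMul j) := by
  refine hom_ext fun β c => ?_
  change partialMul i (partialMul j _) = partialMul j (partialMul i _)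
  simp only [partialMul_term, map_add, pderiv_comm i j, add_right_comm β (Finsupp.single i 1)]
  abel

theorem pairwise_commute (β γ : Fin n → ℕ) (s : Set (Fin n)) :
    s.Pairwise fun i j => Commute ((partialMul i : AddMonoid.End (DiffOp k n)) ^ β i)
      (partialMul j ^ γ j) :=
  fun i _ j _ _ => (partialMul_commute i j).pow_pow _ _

/-- Left multiplication by `∂^β = ∂_1^{β_1} ⋯ ∂_n^{β_n}`. -/
noncomputable def monomialMul (β : Fin n →₀ ℕ) : AddMonoid.End (DiffOp k n) :=
  Finset.univ.noncommProd (fun i => partialMul i ^ β i) (pairwise_commute β β _)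

theorem monomialMul_add (β γ : Fin n →₀ ℕ) :
    (monomialMul (β + γ) : AddMonoid.End (DiffOp k n)) = monomialMul β * monomialMul γ := by
  refine Eq.trans ?_ (Finset.noncommProd_mul_distrib
    (fun i => (partialMul i : AddMonoid.End (DiffOp k n)) ^ β i) (fun i => partialMul i ^ γ i)
    (pairwise_commute β β _) (pairwise_commute γ γ _) (pairwise_commute γ β _))
  exact Finset.noncommProd_congr rfl (fun i _ => pow_add _ _ _) _

theorem monomialMul_single (i : Fin n) :
    (monomialMul (Finsupp.single i 1) : AddMonoid.End (DiffOp k n)) = partialMul i := by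
  classical
  unfold monomialMul
  rw [← Finset.mul_noncommProd_erase _ (Finset.mem_univ i) _ (pairwise_commute _ _ _)
    (pairwise_commute _ _ _), Finset.noncommProd_eq_pow_card _ _ _ 1]
  · simp
  · intro j hj
    simp [(Finset.ne_of_mem_erase hj).symm]

theorem monomialMul_zero : (monomialMul 0 : AddMonoid.End (DiffOp k n)) = 1 := by
  unfold monomialMul
  rw [Finset.noncommProd_eq_pow_card _ _ _ 1 (by simp)]
  simp

theorem monomialMul_induction {p : (Fin n →₀ ℕ) → AddMonoid.End (DiffOp k n) → Prop}
    (zero : p 0 1) (hadd : ∀ β γ S T, p β S → p γ T → p (β + γ) (S * T))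
    (single : ∀ i, p (Finsupp.single i 1) (partialMul i))
    (β : Fin n →₀ ℕ) : p β (monomialMul β) := by
  induction β using Finsupp.induction_linear with
  | zero => rwa [monomialMul_zero]
  | add β γ hβ hγ => rw [monomialMul_add]; exact hadd _ _ _ _ hβ hγ
  | single i m =>
    induction m with
    | zero => rwa [Finsupp.single_zero, monomialMul_zero]
    | succ m ih =>
      rw [Finsupp.single_add, monomialMul_add, monomialMul_single]
      exact hadd _ _ _ _ ih (single i)

/-- The action of `∑ β, c_β ∂^β` by left multiplication, `c_β` acting on coefficients. -/
noncomputable def leftMul : DiffOp k n →+ AddMonoid.End (DiffOp k n) :=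
  Finsupp.liftAddHom fun β => (AddMonoidHom.mulRight (monomialMul β)).comp
    (Module.toAddMonoidEnd (MvPowerSeries (Fin n) k) (DiffOp k n)).toAddMonoidHom

theorem leftMul_term (β : Fin n →₀ ℕ) (c : MvPowerSeries (Fin n) k) (Q : DiffOp k n) :
    leftMul (term β c) Q = c • monomialMul β Q :=
  DFunLike.congr_fun (Finsupp.liftAddHom_apply_single _ _ _) Q

theorem partialMul_smul (i : Fin n) (c : MvPowerSeries (Fin n) k) (Q : DiffOp k n) :
    partialMul i (c • Q) = c • partialMul i Q + MvPowerSeries.pderiv k i c • Q := by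
  suffices h : (partialMul i).comp (DistribSMul.toAddMonoidHom (DiffOp k n) c) =
      (DistribSMul.toAddMonoidHom (DiffOp k n) c).comp (partialMul i) +
        DistribSMul.toAddMonoidHom (DiffOp k n) (MvPowerSeries.pderiv k i c) from
    DFunLike.congr_fun h Q
  refine hom_ext fun β d => ?_
  change partialMul i (c • term β d) =
    c • partialMul i (term β d) + MvPowerSeries.pderiv k i c • term β d
  simp only [smul_term, partialMul_term, smul_add, Derivation.leibniz, map_add, smul_eq_mul]
  rw [mul_comm d, add_assoc]

theorem leftMul_smul (c : MvPowerSeries (Fin n) k) (P Q : DiffOp k n) :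
    leftMul (c • P) Q = c • leftMul P Q := by
  suffices h : ((AddMonoidHom.eval Q).comp leftMul).comp
        (DistribSMul.toAddMonoidHom (DiffOp k n) c) =
      (DistribSMul.toAddMonoidHom (DiffOp k n) c).comp ((AddMonoidHom.eval Q).comp leftMul) from
    DFunLike.congr_fun h P
  refine hom_ext fun β d => ?_
  change leftMul (c • term β d) Q = c • leftMul (term β d) Q
  rw [smul_term, leftMul_term, leftMul_term, mul_smul]

theorem leftMul_partialMul (i : Fin n) (P Q : DiffOp k n) :
    leftMul (partialMul i P) Q = partialMul i (leftMul P Q) := by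
  suffices h : ((AddMonoidHom.eval Q).comp leftMul).comp (partialMul i) =
      (partialMul i).comp ((AddMonoidHom.eval Q).comp leftMul) from
    DFunLike.congr_fun h P
  refine hom_ext fun β d => ?_
  change leftMul (partialMul i (term β d)) Q = partialMul i (leftMul (term β d) Q)
  rw [partialMul_term, map_add]
  change leftMul _ Q + leftMul _ Q = _
  rw [leftMul_term, leftMul_term, leftMul_term, partialMul_smul, add_comm β, monomialMul_add, monomialMul_single]
  rfl

theorem leftMul_monomialMul (β : Fin n →₀ ℕ) (P Q : DiffOp k n) :
    leftMul (monomialMul β P) Q = monomialMul β (leftMul P Q) := by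
  refine monomialMul_induction (p := fun _ T => ∀ P Q, leftMul (T P) Q = T (leftMul P Q))
    (fun _ _ => rfl) (fun _ _ S T hS hT P Q => ?_) leftMul_partialMul β P Q
  change leftMul (S (T P)) Q = S (T (leftMul P Q))
  rw [hS, hT]

theorem leftMul_leftMul (P Q R : DiffOp k n) :
    leftMul (leftMul P Q) R = leftMul P (leftMul Q R) := by
  suffices h : ((AddMonoidHom.eval R).comp leftMul).comp ((AddMonoidHom.eval Q).comp leftMul) =
      (AddMonoidHom.eval (leftMul Q R)).comp leftMul from
    DFunLike.congr_fun h P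
  refine hom_ext fun β c => ?_
  change leftMul (leftMul (term β c) Q) R = leftMul (term β c) (leftMul Q R)
  rw [leftMul_term, leftMul_term, leftMul_smul, leftMul_monomialMul]

theorem monomialMul_one (β : Fin n →₀ ℕ) :
    monomialMul β (term 0 (1 : MvPowerSeries (Fin n) k)) = term β 1 := by
  suffices h : ∀ γ, monomialMul β (term γ (1 : MvPowerSeries (Fin n) k)) = term (γ + β) 1 by
    rw [h, zero_add]
  refine monomialMul_induction (k := k) (p := fun β T => ∀ γ, T (term γ 1) = term (γ + β) 1)
    (fun γ => by simp) (fun β δ S T hS hT γ => ?_) (fun i γ => ?_) β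
  · change S (T _) = _
    rw [hT, hS, add_assoc, add_comm δ]
  · rw [partialMul_term, Derivation.map_one_eq_zero, map_zero, add_zero]

/-- The product: `(∑ β, c_β ∂^β) * Q = ∑ β, c_β (∂^β Q)`. -/
noncomputable instance : Ring (DiffOp k n) :=
  { (inferInstance : AddCommGroup (DiffOp k n)) with
    one := term 0 1
    mul := fun P Q => leftMul P Q
    left_distrib := fun P => map_add (leftMul P)
    right_distrib := fun P P' Q => DFunLike.congr_fun (map_add leftMul P P') Q
    zero_mul := fun Q => DFunLike.congr_fun (map_zero leftMul) Q
    mul_zero := fun P => map_zero (leftMul P)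
    mul_assoc := leftMul_leftMul
    one_mul := fun Q => by
      change leftMul (term 0 1) Q = Q
      rw [leftMul_term, monomialMul_zero, one_smul]
      rfl
    mul_one := fun P => by
      change leftMul P (term 0 1) = P
      suffices h : (AddMonoidHom.eval (term 0 1)).comp leftMul = AddMonoidHom.id (DiffOp k n) from
        DFunLike.congr_fun h P
      refine hom_ext fun β c => ?_
      change leftMul (term β c) (term 0 1) = term β c
      rw [leftMul_term, monomialMul_one, smul_term, mul_one] }

theorem mul_def (P Q : DiffOp k n) : P * Q = leftMul P Q := rfl

theorem one_def : (1 : DiffOp k n) = term 0 1 := rfl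

/-- The defining relation `∂_i c - c ∂_i = ∂c/∂x_i`. -/
theorem partial_mul_coefficient (i : Fin n) (c : MvPowerSeries (Fin n) k) :
    term (Finsupp.single i 1) 1 * term 0 c - term 0 c * term (Finsupp.single i 1) 1 =
      term 0 (MvPowerSeries.pderiv k i c) := by
  rw [mul_def, mul_def, leftMul_term, leftMul_term, monomialMul_single, monomialMul_zero,
    partialMul_term, one_smul, zero_add]
  change _ - c • term (Finsupp.single i 1) 1 = _
  rw [smul_term, mul_one, add_sub_cancel_left]

theorem partialMul_coeffAt (i : Fin n) (P : DiffOp k n) (γ : Fin n →₀ ℕ) :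
    (partialMul i P).coeffAt γ =
      (if 1 ≤ γ i then P.coeffAt (γ - Finsupp.single i 1) else 0) +
        MvPowerSeries.pderiv k i (P.coeffAt γ) := by
  refine congrArg₂ (fun f g : MvPowerSeries (Fin n) k => f + g) ?_ rfl
  change Finsupp.mapDomain (M := MvPowerSeries (Fin n) k)
    (fun β : Fin n →₀ ℕ => β + Finsupp.single i 1) P γ = _
  split_ifs with h
  · have hγ : γ = (γ - Finsupp.single i 1) + Finsupp.single i 1 :=
      (tsub_add_cancel_of_le (Finsupp.single_le_iff.2 h)).symm
    conv_lhs => rw [hγ]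
    exact Finsupp.mapDomain_apply (add_left_injective _) _ _
  · refine Finsupp.mapDomain_of_notMem_range _ _ ?_
    rintro ⟨β, rfl⟩
    simp at h

theorem mul_coeffAt (P Q : DiffOp k n) : ∃ s : Finset (Fin n →₀ ℕ), ∀ γ,
    (P * Q).coeffAt γ = ∑ β ∈ s, P.coeffAt β * (monomialMul β Q).coeffAt γ := by
  refine ⟨Finsupp.support (α := Fin n →₀ ℕ) (M := MvPowerSeries (Fin n) k) P, fun γ => ?_⟩
  let ev : DiffOp k n →+ MvPowerSeries (Fin n) k :=
    AddMonoidHom.mk' (fun R => R.coeffAt γ) fun _ _ => rfl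
  have h : leftMul P Q = ∑ β ∈ Finsupp.support (α := Fin n →₀ ℕ)
      (M := MvPowerSeries (Fin n) k) P,
        P.coeffAt β • monomialMul β Q := by
    have h0 : leftMul P = ∑ β ∈ Finsupp.support (α := Fin n →₀ ℕ)
        (M := MvPowerSeries (Fin n) k) P, AddMonoidHom.mulRight (monomialMul β)
          (Module.toAddMonoidEnd (MvPowerSeries (Fin n) k) (DiffOp k n) (P.coeffAt β)) := rfl
    exact (congrArg (AddMonoidHom.eval Q) h0).trans (map_sum _ _ _)
  change ev (leftMul P Q) = _
  rw [h, map_sum]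
  rfl

/-- The differential operators all of whose coefficients lie in a subring `S` of `k[[x]]` which is
stable under the partial derivatives: the ring of differential operators with coefficients
in `S`. -/
def withCoeffs (S : Subring (MvPowerSeries (Fin n) k))
    (hS : ∀ i, ∀ f ∈ S, MvPowerSeries.pderiv k i f ∈ S) : Subring (DiffOp k n) where
  carrier := {P | ∀ β, P.coeffAt β ∈ S}
  zero_mem' _ := S.zero_mem
  add_mem' hP hQ β := S.add_mem (hP β) (hQ β)
  neg_mem' hP β := S.neg_mem (hP β)
  one_mem' β := by
    classical
    change (Finsupp.single 0 1 : (Fin n →₀ ℕ) →₀ MvPowerSeries (Fin n) k) β ∈ S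
    rw [Finsupp.single_apply]
    split_ifs
    exacts [S.one_mem, S.zero_mem]
  mul_mem' {P Q} hP hQ γ := by
    have key : ∀ β, ∀ Q : DiffOp k n, (∀ γ, Q.coeffAt γ ∈ S) →
        ∀ γ, (monomialMul β Q).coeffAt γ ∈ S := fun β =>
      monomialMul_induction (k := k)
        (p := fun _ T => ∀ Q : DiffOp k n, (∀ γ, Q.coeffAt γ ∈ S) → ∀ γ, (T Q).coeffAt γ ∈ S)
        (fun _ h => h) (fun _ _ _ _ hT hU Q hQ => hT _ (hU _ hQ))
        (fun i Q hQ γ => by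
          rw [partialMul_coeffAt]
          refine S.add_mem ?_ (hS i _ (hQ γ))
          split_ifs
          exacts [hQ _, S.zero_mem]) β
    obtain ⟨s, hs⟩ := mul_coeffAt P Q
    rw [hs]
    exact S.sum_mem fun β _ => S.mul_mem (hP β) (key β Q hQ γ)

theorem withCoeffs_mono {S T : Subring (MvPowerSeries (Fin n) k)}
    (hS : ∀ i, ∀ f ∈ S, MvPowerSeries.pderiv k i f ∈ S)
    (hT : ∀ i, ∀ f ∈ T, MvPowerSeries.pderiv k i f ∈ T) (h : S ≤ T) : withCoeffs S hS ≤ withCoeffs T hT :=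
  fun _ hP β => h (hP β)

/-- The weight `u · α + v · β` of the monomial `x^α ∂^β`. -/
noncomputable def weight (w : (Fin n → ℝ) × (Fin n → ℝ))
    (p : (Fin n →₀ ℕ) × (Fin n →₀ ℕ)) : ℝ := pairing w.1 p.1 + pairing w.2 p.2

theorem monomialMul_weight (w : (Fin n → ℝ) × (Fin n → ℝ)) (hw : ∀ i, 0 ≤ w.1 i + w.2 i)
    (β : Fin n →₀ ℕ) (Q : DiffOp k n) (p : (Fin n →₀ ℕ) × (Fin n →₀ ℕ))
    (hp : MvPowerSeries.coeff p.1 ((monomialMul β Q).coeffAt p.2) ≠ 0) :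
    ∃ l : (Fin n →₀ ℕ) × (Fin n →₀ ℕ), MvPowerSeries.coeff l.1 (Q.coeffAt l.2) ≠ 0 ∧
      weight w p ≤ pairing w.2 β + weight w l := by
  refine monomialMul_induction (k := k)
    (p := fun β T => ∀ (Q : DiffOp k n) (p : (Fin n →₀ ℕ) × (Fin n →₀ ℕ)),
      MvPowerSeries.coeff p.1 ((T Q).coeffAt p.2) ≠ 0 →
      ∃ l : (Fin n →₀ ℕ) × (Fin n →₀ ℕ), MvPowerSeries.coeff l.1 (Q.coeffAt l.2) ≠ 0 ∧
        weight w p ≤ pairing w.2 β + weight w l)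
    (fun Q p hp => ⟨p, hp, by simp [pairing]⟩) (fun β γ S T hS hT Q p hp => ?_)
    (fun i Q p hp => ?_) β Q p hp
  · obtain ⟨l, hl, h1⟩ := hS (T Q) p hp
    obtain ⟨m, hm, h2⟩ := hT Q l hl
    refine ⟨m, hm, ?_⟩
    rw [pairing_add]
    linarith
  · have hsingle : ∀ u : Fin n → ℝ, pairing u (Finsupp.single i 1) = u i := fun u => by
      simp [pairing, Finsupp.single_apply]
    rw [partialMul_coeffAt, map_add] at hp
    rcases ne_or_eq (MvPowerSeries.coeff p.1 (MvPowerSeries.pderiv k i (Q.coeffAt p.2))) 0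
      with h | h
    · rw [MvPowerSeries.coeff_pderiv] at h
      refine ⟨(p.1 + Finsupp.single i 1, p.2), left_ne_zero_of_mul h, ?_⟩
      simp only [weight, pairing_add, hsingle]
      linarith [hw i]
    · rw [h, add_zero] at hp
      split_ifs at hp with h1
      · refine ⟨(p.1, p.2 - Finsupp.single i 1), hp, ?_⟩
        have h2 : pairing w.2 p.2 =
            pairing w.2 (p.2 - Finsupp.single i 1) + w.2 i := by
          rw [← hsingle w.2, ← pairing_add,
            tsub_add_cancel_of_le (Finsupp.single_le_iff.2 h1)]
        simp only [weight, hsingle]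
        linarith
      · exact absurd (map_zero _) hp

/-- The weights `w = (u, v)` on the ring of differential operators: `x^α ∂^β` has weight
`u · α + v · β`. The condition `u_i + v_i ≥ 0` makes this compatible with the product. -/
noncomputable def weighting (k : Type*) [Field k] (w : (Fin n → ℝ) × (Fin n → ℝ))
    (hw : ∀ i, 0 ≤ w.1 i + w.2 i) :
    Weighting (DiffOp k n) ((Fin n →₀ ℕ) × (Fin n →₀ ℕ)) k where
  coeff := AddMonoidHom.mk' (fun P p => MvPowerSeries.coeff p.1 (P.coeffAt p.2)) fun P Q => by
    ext p
    simp [coeffAt_add]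
  coeff_injective P Q h := Finsupp.ext fun β => MvPowerSeries.ext fun α => congrFun h (α, β)
  wt := weight w
  one_le p h := by
    classical
    change MvPowerSeries.coeff p.1
      ((Finsupp.single 0 1 : (Fin n →₀ ℕ) →₀ MvPowerSeries (Fin n) k) p.2) ≠ 0 at h
    rw [Finsupp.single_apply] at h
    split_ifs at h with h0
    · rw [MvPowerSeries.coeff_one] at h
      split_ifs at h with h1
      · simp [weight, pairing, h1, ← h0]
      · exact absurd rfl h
    · exact absurd (map_zero _) h
  mul_le P Q p h := by
    classical
    obtain ⟨s, hs⟩ := mul_coeffAt P Q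
    simp only [AddMonoidHom.mk'_apply, hs, map_sum] at h
    obtain ⟨β, -, h⟩ := Finset.exists_ne_zero_of_sum_ne_zero h
    rw [MvPowerSeries.coeff_mul] at h
    obtain ⟨a, ha, h⟩ := Finset.exists_ne_zero_of_sum_ne_zero h
    obtain ⟨l, hl, h1⟩ := monomialMul_weight w hw β Q (a.2, p.2) (right_ne_zero_of_mul h)
    refine ⟨(a.1, β), l, left_ne_zero_of_mul h, hl, ?_⟩
    simp only [weight] at h1 ⊢
    rw [← Finset.HasAntidiagonal.mem_antidiagonal.1 ha, pairing_add]
    linarith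

/-- `D`: the operators with coefficients in `k[x]`. -/
noncomputable abbrev polynomial (k : Type*) [Field k] (n : ℕ) : Subring (DiffOp k n) :=
  withCoeffs (polynomialRing k n) fun i _ => pderiv_mem_polynomialRing i

/-- `D_alg`: the operators with coefficients in the localization of `k[x]` at the origin. -/
noncomputable abbrev algebraic (k : Type*) [Field k] (n : ℕ) : Subring (DiffOp k n) :=
  withCoeffs (localRing k n) fun i _ => pderiv_mem_localRing i

/-- `D_0`: the operators with coefficients in the ring of convergent power series. -/
noncomputable abbrev analytic (n : ℕ) : Subring (DiffOp ℂ n) :=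
  withCoeffs (analyticRing n) fun i _ => pderiv_mem_analyticRing i

theorem polynomial_le_algebraic : polynomial k n ≤ algebraic k n :=
  withCoeffs_mono _ _ polynomialRing_le_localRing

theorem algebraic_le_analytic : algebraic ℂ n ≤ analytic n :=
  withCoeffs_mono _ _ localRing_le_analyticRing

end DiffOp
end operators

/-- The local weight vectors `u` on `x`. -/
def Uloc (n : ℕ) : Set (Fin n → ℝ) := {u | ∀ i, u i ≤ 0}

/-- The local weight vectors `w = (u, v)` on `x` and `∂`. -/
def Wloc (n : ℕ) : Set ((Fin n → ℝ) × (Fin n → ℝ)) :=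
  {w | ∀ i, w.1 i ≤ 0 ∧ 0 ≤ w.1 i + w.2 i}

/-- The filtration of `k[[x]]` by the order with respect to `u ∈ Uloc`. As `u ≤ 0`, the maximum of
`u · α` over the monomials `x^α` of a nonzero series exists. -/
noncomputable def seriesOrder (k : Type*) [Field k] {n : ℕ} (u : Uloc n) :
    Weighting (MvPowerSeries (Fin n) k) (Fin n →₀ ℕ) k :=
  seriesWeighting k u.1

/-- The filtration of the operators over `k[[x]]` by the order with respect to `w ∈ Wloc`. As
`u ≤ 0`, the maximum of `u · α + v · β` over the monomials of a nonzero operator exists. -/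
noncomputable def operatorOrder (k : Type*) [Field k] {n : ℕ} (w : Wloc n) :
    Weighting (DiffOp k n) ((Fin n →₀ ℕ) × (Fin n →₀ ℕ)) k :=
  DiffOp.weighting k w.1 fun i => (w.2 i).2

section comparison

variable {A ι k W : Type*} [Ring A] [Field k]

/-- `gr(R') in(I) = in(R' I)` for every left ideal `I` of `R`, where `R ⊆ R'`. -/
def InitialIdealExtends (F : Weighting A ι k) (R R' : Subring A) (h : R ≤ R') : Prop :=
  ∀ I : Ideal R, Ideal.map (F.grInclusion h) ((F.restrict R).initialIdeal I) =
    (F.restrict R').initialIdeal (Ideal.map (Subring.inclusion h) I)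

/-- For every left ideal `I` of `R`, where `R ⊆ R'`, the open Gröbner fan of `I`, cut along the
strata of `R'`, refines the open Gröbner fan of `R' I`. -/
def FanRefines (F : W → Weighting A ι k) (R R' : Subring A) (h : R ≤ R') : Prop :=
  ∀ I : Ideal R, ∀ C ∈ groebnerFan F R I, ∀ w : W, (C ∩ stratum F R' w).Nonempty →
    ∃ C' ∈ groebnerFan F R' (Ideal.map (Subring.inclusion h) I), C ∩ stratum F R' w ⊆ C'

end comparison

end GrobnerComparison

open GrobnerComparison

/-! Let `R ⊆ R'` be rings of power series and `I` a left ideal, either of `R` or of the operators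
with coefficients in `R`. The nontrivial inclusion says that the initial form of every `P` in the
extended ideal comes from `I`. It suffices to write `P`, of order at most `t`, as a sum of products
`c * g` with `c` over `R'` of order at most `0` and `g ∈ I` of order at most `t`
(`InitialIdealExtends.of_closure`): no cancellation of terms of order above `t` is then left, and
taking symbols in degrees `0` and `t` gives the claim.

To find such an expression, start from any `P = ∑ a_j g_j` with `g_j ∈ I`. For operators, the
derivatives in the multipliers are absorbed into the `g_j`, so that the `a_j` are power series and
act coefficientwise. Since `u ≤ 0`, the exponents `α` with `u · α` below a given bound form an
up-set, which is generated by finitely many monomials (Dickson). Hence "order at most `t`" says that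
each coefficient of `P` is a combination of these monomials, with multipliers `d` in `R'`
(`HasMonomialDivision`). So `(a, d)` solves a finite homogeneous linear system over `R`. If `R'` is
flat over `R`, this solution is an `R'`-combination of solutions over `R`, and each of those yields
an element of `I` that obeys the same order bound (`LinearlyFlat.exists_bounded_combination`). The
multipliers in `R'` have order at most `0` automatically.

What remains is flatness, in the form of the equational criterion `LinearlyFlat`. For `k[x] ⊆
k[x]_(x)` and `k[x]_(x) ⊆ k[[x]]` denominators are cleared. Over `k[x]` and `ℂ{x}` the ring of
formal series is flat because it is the adic completion of a Noetherian ring (`flat_powerSeries`);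
that `ℂ{x}` is Noetherian follows from a convergent division theorem
(`MonomialNumbering.exists_division`). Flatness of `ℂ{x}` over the local ring descends from
`ℂ[[x]]`.

The statement on fans is formal: an identification of graded rings of `R'` that preserves
coefficients carries extended initial ideals to extended initial ideals. -/

namespace GrobnerComparison

/-! ### Monomials: Dickson's lemma and a multiplicative numbering. -/

/-- Dickson's lemma. -/
theorem exists_finset_le {n : ℕ} (E : Set (Fin n →₀ ℕ)) :
    ∃ B : Finset (Fin n →₀ ℕ), ↑B ⊆ E ∧ ∀ a ∈ E, ∃ b ∈ B, b ≤ a := by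
  have hE : E.IsPWO := Set.isPWO_of_wellQuasiOrderedLE E
  -- The minimal elements of `E` form an antichain in a well-quasi-order, hence a finite set.
  have hfin := (setOfPred_minimal_antichain (· ∈ E)).finite_of_partiallyWellOrderedOn
    (hE.mono fun _ h => h.1)
  refine ⟨hfin.toFinset, fun a ha => ((Set.Finite.mem_toFinset _).1 ha).1, fun a ha => ?_⟩
  obtain ⟨b, hb, hm⟩ := hE.exists_le_minimal ha
  exact ⟨b, (Set.Finite.mem_toFinset _).2 hm, hb⟩

/-- A multiplicative numbering of the monomials. It orders the monomials by a total order of type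
`ω`, and its negative powers serve as weights of norms. -/
structure MonomialNumbering (n : ℕ) where
  num : (Fin n →₀ ℕ) → ℕ
  injective : Function.Injective num
  num_add : ∀ α β, num (α + β) = num α * num β
  bound : ℕ
  two_pow_le : ∀ α, 2 ^ α.degree ≤ num α
  le_pow : ∀ α, num α ≤ bound ^ α.degree

/-- The numbering of `x^α` by `∏ p_i ^ α_i`, where the `p_i` are distinct primes. -/
theorem nonempty_monomialNumbering (n : ℕ) : Nonempty (MonomialNumbering n) := by
  let p : Fin n → ℕ := fun i => Nat.nth Nat.Prime i
  have hp : ∀ i, (p i).Prime := fun i => Nat.prime_nth_prime i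
  have hinj : Function.Injective p := fun i j h =>
    Fin.ext (Nat.nth_injective Nat.infinite_setOfPred_prime h)
  refine ⟨⟨fun α => ∏ i, p i ^ α i, fun α β h => ?_, fun α β => ?_, ∏ i, p i, fun α => ?_,
    fun α => ?_⟩⟩
  · have key : ∀ (γ : Fin n →₀ ℕ) i, (∏ j, p j ^ γ j).factorization (p i) = γ i := by
      intro γ i
      rw [Nat.factorization_prod fun j _ => pow_ne_zero _ (hp j).ne_zero, Finsupp.finsetSum_apply,
        Finset.sum_eq_single i]
      · simp [(hp i).factorization]
      · intro j _ hj
        simp [(hp j).factorization, hinj.ne hj]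
      · simp
    ext i
    rw [← key α, ← key β]
    exact congrArg (fun m => Nat.factorization m (p i)) h
  · simp [pow_add, Finset.prod_mul_distrib]
  · rw [Finsupp.degree_eq_sum, ← Finset.prod_pow_eq_pow_sum]
    exact Finset.prod_le_prod' fun i _ => Nat.pow_le_pow_left (hp i).two_le _
  · rw [Finsupp.degree_eq_sum, ← Finset.prod_pow_eq_pow_sum]
    refine Finset.prod_le_prod' fun i _ => Nat.pow_le_pow_left ?_ _
    exact Nat.le_of_dvd (Finset.prod_pos fun j _ => (hp j).pos)
      (Finset.dvd_prod_of_mem p (Finset.mem_univ i))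

/-! ### Weighted norms on convergent power series. -/

namespace MonomialNumbering

variable {n : ℕ} (N : MonomialNumbering n)

theorem one_le (α : Fin n →₀ ℕ) : 1 ≤ N.num α :=
  (Nat.one_le_two_pow).trans (N.two_pow_le α)

/-- The monomials up to number `m`. -/
noncomputable def upTo (m : ℕ) : Finset (Fin n →₀ ℕ) :=
  ((Set.finite_Iic m).preimage N.injective.injOn).toFinset

theorem mem_upTo {m : ℕ} {α : Fin n →₀ ℕ} : α ∈ N.upTo m ↔ N.num α ≤ m := by
  simp [upTo]

/-- The inverse of the number of a monomial. -/
noncomputable def inv (α : Fin n →₀ ℕ) : ℝ := (N.num α : ℝ)⁻¹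

theorem inv_pos (α : Fin n →₀ ℕ) : 0 < N.inv α :=
  _root_.inv_pos.2 (Nat.cast_pos.2 (N.one_le α))

theorem inv_le_one (α : Fin n →₀ ℕ) : N.inv α ≤ 1 :=
  inv_le_one_of_one_le₀ (by exact_mod_cast N.one_le α)

theorem inv_add (α β : Fin n →₀ ℕ) : N.inv (α + β) = N.inv α * N.inv β := by
  simp [inv, N.num_add, mul_comm]

/-- The norm with weights `N(α)^(-s)` is finite. -/
def Summable (s : ℕ) (f : (Fin n →₀ ℕ) → ℂ) : Prop :=
  _root_.Summable fun α => ‖f α‖ * N.inv α ^ s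

variable {N}

theorem Summable.mono {s t : ℕ} (hst : s ≤ t) {f : (Fin n →₀ ℕ) → ℂ} (h : N.Summable s f) :
    N.Summable t f :=
  h.of_nonneg_of_le (fun α => by have := N.inv_pos α; positivity) fun α =>
    mul_le_mul_of_nonneg_left (pow_le_pow_of_le_one (N.inv_pos α).le (N.inv_le_one α) hst)
      (norm_nonneg _)

/-- The bounds `2 ^ |α| ≤ N(α) ≤ bound ^ |α|` make the weights `N(α)⁻ˢ` comparable with geometric
weights `r ^ |α|` in both directions. Given `r`, take `s` with `2⁻ˢ < r`; given `s`, take `r =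
(bound + 1)⁻ˢ`, where the `+ 1` ensures a positive base. -/
theorem isConvergent_iff {f : MvPowerSeries (Fin n) ℂ} :
    IsConvergent f ↔ ∃ s, N.Summable s fun α => MvPowerSeries.coeff α f := by
  constructor
  · rintro ⟨r, hr, h⟩
    obtain ⟨s, hs⟩ := exists_pow_lt_of_lt_one hr (show (2⁻¹ : ℝ) < 1 by norm_num)
    refine ⟨s, h.of_nonneg_of_le (fun α => by have := N.inv_pos α; positivity) fun α => ?_⟩
    refine mul_le_mul_of_nonneg_left ?_ (norm_nonneg _)
    calc N.inv α ^ s ≤ ((2⁻¹ : ℝ) ^ α.degree) ^ s := by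
          refine pow_le_pow_left₀ (N.inv_pos α).le ?_ s
          rw [inv_pow]
          exact inv_anti₀ (by positivity) (by exact_mod_cast N.two_pow_le α)
      _ = ((2⁻¹ : ℝ) ^ s) ^ α.degree := by rw [← pow_mul, ← pow_mul, mul_comm]
      _ ≤ _ := pow_le_pow_left₀ (by positivity) hs.le _
  · rintro ⟨s, h⟩
    have hb : (0 : ℝ) < (N.bound : ℝ) + 1 := by positivity
    refine ⟨((N.bound : ℝ) + 1)⁻¹ ^ s, by positivity,
      h.of_nonneg_of_le (fun α => by positivity) fun α => ?_⟩
    refine mul_le_mul_of_nonneg_left ?_ (norm_nonneg _)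
    rw [← pow_mul, mul_comm, pow_mul]
    refine pow_le_pow_left₀ (by positivity) ?_ s
    rw [inv_pow]
    refine inv_anti₀ (Nat.cast_pos.2 (N.one_le α)) ?_
    calc (N.num α : ℝ) ≤ (N.bound : ℝ) ^ α.degree := by exact_mod_cast N.le_pow α
      _ ≤ _ := pow_le_pow_left₀ (by positivity) (by linarith) _

variable (N)

/-- `f` has leading monomial `x^a` with coefficient `1`. -/
def Leads (a : Fin n →₀ ℕ) (f : MvPowerSeries (Fin n) ℂ) : Prop :=
  MvPowerSeries.coeff a f = 1 ∧ ∀ β, N.num β < N.num a → MvPowerSeries.coeff β f = 0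

variable {N}

theorem exists_leads {f : MvPowerSeries (Fin n) ℂ} (hf : f ≠ 0) :
    ∃ a, ∃ c : ℂ, N.Leads a (MvPowerSeries.C c * f) ∧ MvPowerSeries.coeff a f ≠ 0 := by
  obtain ⟨b, hb⟩ : ∃ b, MvPowerSeries.coeff b f ≠ 0 := by
    by_contra! h
    exact hf (MvPowerSeries.ext h)
  obtain ⟨a, ha, hmin⟩ := WellFounded.has_min (measure N.num).wf
    {b | MvPowerSeries.coeff b f ≠ 0} ⟨b, hb⟩
  refine ⟨a, (MvPowerSeries.coeff a f)⁻¹, ⟨?_, fun β hβ => ?_⟩, ha⟩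
  · rw [MvPowerSeries.coeff_C_mul, inv_mul_cancel₀ ha]
  · rw [MvPowerSeries.coeff_C_mul, not_not.1 fun h => hmin β h hβ, mul_zero]

/-- Numbers of monomials are integers and the numbering is injective, so every nonleading monomial
of `f` has number at least `A + 1`, where `A = N(a)`. Raising the exponent from `t` to `t + e`
therefore shrinks the tail by at least `(A + 1)⁻ᵉ`, but the leading weight only by `A⁻ᵉ`. The ratio
of the two decays like `(A / (A + 1)) ^ e`. -/
theorem Leads.tail_le {a : Fin n →₀ ℕ} {f : MvPowerSeries (Fin n) ℂ} (hf : N.Leads a f)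
    (hc : IsConvergent f) : ∃ s₀, ∀ s ≥ s₀, ∀ S : Finset (Fin n →₀ ℕ), a ∉ S →
      ∑ η ∈ S, ‖MvPowerSeries.coeff η f‖ * N.inv η ^ s ≤ 1 / 2 * N.inv a ^ s := by
  obtain ⟨t, ht⟩ := (isConvergent_iff (N := N)).1 hc
  set M := ∑' η, ‖MvPowerSeries.coeff η f‖ * N.inv η ^ t with hM
  set A : ℝ := (N.num a : ℝ) with hA
  have hA1 : 1 ≤ A := by rw [hA]; exact_mod_cast N.one_le a
  have hM0 : 0 ≤ M := tsum_nonneg fun η => by have := N.inv_pos η; positivity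
  have hlim := (tendsto_pow_atTop_nhds_zero_of_lt_one (r := A / (A + 1)) (by positivity)
    (by rw [div_lt_one (by positivity)]; linarith)).const_mul (M * A ^ t)
  rw [mul_zero] at hlim
  obtain ⟨d, hd⟩ := Filter.eventually_atTop.1 (hlim.eventually_le_const (show (0 : ℝ) < 1 / 2 by norm_num))
  refine ⟨t + d, fun s hs S hS => ?_⟩
  obtain ⟨e, rfl⟩ : ∃ e, s = t + e := ⟨s - t, by omega⟩
  have he := hd e (by omega)
  calc ∑ η ∈ S, ‖MvPowerSeries.coeff η f‖ * N.inv η ^ (t + e)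
      ≤ ∑ η ∈ S, ‖MvPowerSeries.coeff η f‖ * N.inv η ^ t * (A + 1)⁻¹ ^ e := by
        refine Finset.sum_le_sum fun η hη => ?_
        rw [pow_add, ← mul_assoc]
        rcases eq_or_ne (MvPowerSeries.coeff η f) 0 with h0 | h0
        · simp [h0]
        refine mul_le_mul_of_nonneg_left ?_ (by have := N.inv_pos η; positivity)
        refine pow_le_pow_left₀ (N.inv_pos η).le (inv_anti₀ (by positivity) ?_) e
        have h1 : N.num a ≤ N.num η := not_lt.1 fun h => h0 (hf.2 η h)
        have h2 : N.num a ≠ N.num η := fun h => hS (N.injective h ▸ hη)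
        rw [hA]
        exact_mod_cast Nat.succ_le_of_lt (lt_of_le_of_ne h1 h2)
    _ ≤ M * (A + 1)⁻¹ ^ e := by
        rw [← Finset.sum_mul]
        refine mul_le_mul_of_nonneg_right ?_ (by positivity)
        exact ht.sum_le_tsum S fun η _ => by have := N.inv_pos η; positivity
    _ = (M * A ^ t * (A / (A + 1)) ^ e) * N.inv a ^ (t + e) := by
        have : N.inv a = A⁻¹ := rfl
        rw [this, div_pow, pow_add, inv_pow, inv_pow, inv_pow]
        field_simp
    _ ≤ _ := mul_le_mul_of_nonneg_right he (by have := N.inv_pos a; positivity)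

/-! ### Triangular systems and division of convergent power series. -/

/-- A unitriangular system of linear equations indexed by monomials is solvable. -/
theorem exists_triangular_solution (G : (Fin n →₀ ℕ) → (Fin n →₀ ℕ) → ℂ) (hG : ∀ γ, G γ γ = 1)
    (g : (Fin n →₀ ℕ) → ℂ) :
    ∃ h : (Fin n →₀ ℕ) → ℂ, ∀ δ, g δ = ∑ γ ∈ N.upTo (N.num δ), h γ * G γ δ := by
  classical
  -- Well-founded recursion on numbers. The guard in the sum always holds: a monomial of number at
  -- most `N.num δ` other than `δ` has smaller number by injectivity.
  let F : ∀ δ, (∀ γ, N.num γ < N.num δ → ℂ) → ℂ := fun δ ih =>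
    g δ - ∑ γ ∈ (N.upTo (N.num δ)).erase δ,
      if hγ : N.num γ < N.num δ then ih γ hγ * G γ δ else 0
  let h := (measure N.num).wf.fix F
  have hh : ∀ δ, h δ = g δ - ∑ γ ∈ (N.upTo (N.num δ)).erase δ, h γ * G γ δ := fun δ => by
    refine ((measure N.num).wf.fix_eq F δ).trans ?_
    simp only [F]
    congr 1
    refine Finset.sum_congr rfl fun γ hγ => ?_
    obtain ⟨h1, h2⟩ := Finset.mem_erase.1 hγ
    rw [dif_pos (lt_of_le_of_ne (N.mem_upTo.1 h2) (N.injective.ne h1))]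
  refine ⟨h, fun δ => ?_⟩
  rw [← Finset.add_sum_erase _ _ (N.mem_upTo.2 le_rfl : δ ∈ N.upTo (N.num δ)), hG, mul_one]
  have := hh δ
  linear_combination -this

/-- If the off-diagonal part of a triangular system has small norm, then the solution has finite
norm. -/
theorem summable_triangular_solution {G : (Fin n →₀ ℕ) → (Fin n →₀ ℕ) → ℂ} (hG : ∀ γ, G γ γ = 1)
    (hG0 : ∀ γ δ, N.num δ < N.num γ → G γ δ = 0) {s : ℕ}
    (hGs : ∀ γ, ∀ S : Finset (Fin n →₀ ℕ), γ ∉ S →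
      ∑ δ ∈ S, ‖G γ δ‖ * N.inv δ ^ s ≤ 1 / 2 * N.inv γ ^ s)
    {g h : (Fin n →₀ ℕ) → ℂ} (hg : N.Summable s g)
    (hgh : ∀ δ, g δ = ∑ γ ∈ N.upTo (N.num δ), h γ * G γ δ) : N.Summable s h := by
  classical
  have hpos : ∀ δ, 0 ≤ N.inv δ ^ s := fun δ => by have := N.inv_pos δ; positivity
  -- The estimate `‖h‖ ≤ ‖g‖ + ‖h‖ / 2` gives `‖h‖ ≤ 2 ‖g‖` once `‖h‖` is known to be finite. It is
  -- therefore proved for finite truncations, which triangularity makes closed systems; the bound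
  -- does not depend on `m`.
  have key : ∀ m, ∑ δ ∈ N.upTo m, ‖h δ‖ * N.inv δ ^ s ≤ 2 * ∑' δ, ‖g δ‖ * N.inv δ ^ s := by
    intro m
    have h1 : ∀ δ ∈ N.upTo m, ‖h δ‖ * N.inv δ ^ s ≤ ‖g δ‖ * N.inv δ ^ s +
        ∑ γ ∈ (N.upTo m).erase δ, ‖h γ‖ * (‖G γ δ‖ * N.inv δ ^ s) := by
      intro δ hδ
      have h2 : h δ = g δ - ∑ γ ∈ (N.upTo m).erase δ, h γ * G γ δ := by
        have h3 : g δ = ∑ γ ∈ N.upTo m, h γ * G γ δ := by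
          rw [hgh]
          refine Finset.sum_subset (fun γ hγ => ?_) fun γ _ hγ => ?_
          · exact N.mem_upTo.2 ((N.mem_upTo.1 hγ).trans (N.mem_upTo.1 hδ))
          · rw [hG0 _ _ (not_le.1 fun hle => hγ (N.mem_upTo.2 hle)), mul_zero]
        rw [h3, ← Finset.add_sum_erase _ _ hδ, hG, mul_one, add_sub_cancel_right]
      calc _ ≤ (‖g δ‖ + ∑ γ ∈ (N.upTo m).erase δ, ‖h γ * G γ δ‖) * N.inv δ ^ s := by
            refine mul_le_mul_of_nonneg_right ?_ (hpos δ)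
            rw [h2]
            exact (norm_sub_le _ _).trans (add_le_add_right (norm_sum_le _ _) _)
        _ = _ := by
            rw [add_mul, Finset.sum_mul]
            simp only [norm_mul, mul_assoc]
    have h2 : ∑ δ ∈ N.upTo m, ∑ γ ∈ (N.upTo m).erase δ, ‖h γ‖ * (‖G γ δ‖ * N.inv δ ^ s) ≤
        1 / 2 * ∑ γ ∈ N.upTo m, ‖h γ‖ * N.inv γ ^ s := by
      rw [Finset.sum_comm' (s' := fun γ => (N.upTo m).erase γ) (t' := N.upTo m)
        (by intro x y; simp only [Finset.mem_erase]; tauto), Finset.mul_sum]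
      refine Finset.sum_le_sum fun γ _ => ?_
      rw [← Finset.mul_sum]
      have := mul_le_mul_of_nonneg_left (hGs γ _ (Finset.notMem_erase γ (N.upTo m)))
        (norm_nonneg (h γ))
      linarith
    have h3 := Finset.sum_le_sum h1
    rw [Finset.sum_add_distrib] at h3
    have h4 := hg.sum_le_tsum (N.upTo m) fun δ _ => mul_nonneg (norm_nonneg (g δ)) (hpos δ)
    linarith
  refine summable_of_sum_le (fun δ => mul_nonneg (norm_nonneg _) (hpos δ)) fun S =>
    le_trans ?_ (key (S.sup N.num))
  exact Finset.sum_le_sum_of_subset_of_nonneg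
    (fun δ hδ => N.mem_upTo.2 (Finset.le_sup (f := N.num) hδ))
    fun δ _ _ => mul_nonneg (norm_nonneg _) (hpos δ)

/-- Division with remainder of convergent power series by finitely many convergent power series
with given leading monomials. -/
theorem exists_division {ι : Type*} [Fintype ι] {a : ι → Fin n →₀ ℕ}
    {f : ι → MvPowerSeries (Fin n) ℂ} (hf : ∀ i, N.Leads (a i) (f i))
    (hc : ∀ i, IsConvergent (f i)) {g : MvPowerSeries (Fin n) ℂ} (hg : IsConvergent g) :
    ∃ (q : ι → MvPowerSeries (Fin n) ℂ) (r : MvPowerSeries (Fin n) ℂ),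
      (∀ i, IsConvergent (q i)) ∧ IsConvergent r ∧ g = ∑ i, q i * f i + r ∧
      ∀ i β, a i ≤ β → MvPowerSeries.coeff β r = 0 := by
  classical
  obtain ⟨j, hj, hj'⟩ : ∃ j : (Fin n →₀ ℕ) → Option ι,
      (∀ γ i, j γ = some i → a i ≤ γ) ∧ ∀ γ, j γ = none → ∀ i, ¬ a i ≤ γ := by
    refine ⟨fun γ => if h : ∃ i, a i ≤ γ then some h.choose else none, fun γ i h => ?_,
      fun γ h i hi => ?_⟩
    · dsimp only at h
      split_ifs at h with h1
      exact Option.some.inj h ▸ h1.choose_spec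
    · dsimp only at h
      rw [dif_pos ⟨i, hi⟩] at h
      exact absurd h (by simp)
  -- `P γ` is `x^γ` itself if no `x^(a i)` divides it, and otherwise the multiple of the selected `f
  -- i` with leading monomial `x^γ`. Expanding `g` in the series `P γ` is a unitriangular system
  -- with matrix `G`: the reducible `γ` will contribute to the quotients, the others to the
  -- remainder.
  let P : (Fin n →₀ ℕ) → MvPowerSeries (Fin n) ℂ := fun γ =>
    (j γ).elim (MvPowerSeries.monomial γ 1) fun i => MvPowerSeries.monomial (γ - a i) 1 * f i
  have hPn : ∀ γ δ, j γ = none → MvPowerSeries.coeff δ (P γ) = if δ = γ then 1 else 0 :=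
    fun γ δ h => by simp only [P, h, Option.elim_none, MvPowerSeries.coeff_monomial]
  have hPs : ∀ γ δ i, j γ = some i → MvPowerSeries.coeff δ (P γ) =
      if γ - a i ≤ δ then MvPowerSeries.coeff (δ - (γ - a i)) (f i) else 0 :=
    fun γ δ i h => by
      simp only [P, h, Option.elim_some, MvPowerSeries.coeff_monomial_mul, one_mul]
  let G : (Fin n →₀ ℕ) → (Fin n →₀ ℕ) → ℂ := fun γ δ => MvPowerSeries.coeff δ (P γ)
  have hG1 : ∀ γ, G γ γ = 1 := fun γ => by
    rcases h : j γ with _ | i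
    · exact (hPn γ γ h).trans (if_pos rfl)
    · refine (hPs γ γ i h).trans ?_
      rw [if_pos tsub_le_self, tsub_tsub_cancel_of_le (hj γ i h)]
      exact (hf i).1
  have hG0 : ∀ γ δ, N.num δ < N.num γ → G γ δ = 0 := fun γ δ hlt => by
    rcases h : j γ with _ | i
    · exact (hPn γ δ h).trans (if_neg fun h0 : δ = γ => hlt.ne (h0 ▸ rfl))
    · refine (hPs γ δ i h).trans ?_
      split_ifs with hle
      · refine (hf i).2 _ ?_
        -- Multiplicativity of the numbering makes the order of monomials compatible with products,
        -- so the common factor `x^(γ - a i)` can be cancelled.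
        rw [← tsub_add_cancel_of_le hle, N.num_add] at hlt
        conv_rhs at hlt => rw [← tsub_add_cancel_of_le (hj γ i h), N.num_add, mul_comm]
        exact lt_of_mul_lt_mul_right hlt (Nat.zero_le _)
      · rfl
  choose s hs using fun i => (hf i).tail_le (hc i)
  obtain ⟨t, ht⟩ := (isConvergent_iff (N := N)).1 hg
  -- One exponent for which `g` has finite norm and the tail of every `f i` is at most half its
  -- leading term. Multiplication by `x^m` scales all weights by `N.inv m ^ e`, so the rows of `G`
  -- inherit the bound.
  set e := max t (Finset.univ.sup s) with he
  have hGs : ∀ γ, ∀ S : Finset (Fin n →₀ ℕ), γ ∉ S →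
      ∑ δ ∈ S, ‖G γ δ‖ * N.inv δ ^ e ≤ 1 / 2 * N.inv γ ^ e := by
    intro γ S hγ
    have hpos : 0 ≤ 1 / 2 * N.inv γ ^ e := by have := N.inv_pos γ; positivity
    rcases h : j γ with _ | i
    · refine (Finset.sum_nonpos fun δ hδ => ?_).trans hpos
      rw [show G γ δ = 0 from (hPn γ δ h).trans (if_neg fun h0 : δ = γ => hγ (h0 ▸ hδ))]
      simp
    · set m := γ - a i with hm
      have hma : m + a i = γ := tsub_add_cancel_of_le (hj γ i h)
      have h1 : ∑ δ ∈ S, ‖G γ δ‖ * N.inv δ ^ e ≤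
          ∑ η ∈ (S.filter (m ≤ ·)).image (· - m),
            ‖MvPowerSeries.coeff η (f i)‖ * N.inv η ^ e * N.inv m ^ e := by
        rw [Finset.sum_image, Finset.sum_filter]
        · refine Finset.sum_le_sum fun δ _ => ?_
          rw [show G γ δ = _ from hPs γ δ i h]
          split_ifs with hle
          · conv_lhs => rw [← tsub_add_cancel_of_le hle, N.inv_add, mul_pow]
            rw [tsub_add_cancel_of_le hle, mul_assoc]
          · simp
        · intro x hx y hy hxy
          rw [← tsub_add_cancel_of_le (Finset.mem_filter.1 hx).2,
            ← tsub_add_cancel_of_le (Finset.mem_filter.1 hy).2]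
          exact congrArg (· + m) hxy
      have h2 := hs i e ((Finset.le_sup (Finset.mem_univ i)).trans (le_max_right _ _))
        ((S.filter (m ≤ ·)).image (· - m)) (fun hmem => by
          obtain ⟨δ, hδ, h3⟩ := Finset.mem_image.1 hmem
          obtain ⟨hδS, hle⟩ := Finset.mem_filter.1 hδ
          refine hγ ?_
          rw [← hma, ← h3, add_comm, tsub_add_cancel_of_le hle]
          exact hδS)
      refine h1.trans ?_
      rw [← Finset.sum_mul, ← hma, N.inv_add, mul_pow, mul_comm (N.inv m ^ e), ← mul_assoc]
      exact mul_le_mul_of_nonneg_right h2 (by have := N.inv_pos m; positivity)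
  obtain ⟨h, hgh⟩ := exists_triangular_solution (N := N) G hG1
    fun α => MvPowerSeries.coeff α g
  have hh := summable_triangular_solution hG1 hG0 hGs (ht.mono (le_max_left _ _)) hgh
  -- The quotient `q i` collects the terms `h γ` for which `f i` was selected, with `ε = γ - a i`.
  let q : ι → MvPowerSeries (Fin n) ℂ := fun i ε =>
    if j (ε + a i) = some i then h (ε + a i) else 0
  let r : MvPowerSeries (Fin n) ℂ := fun ε => if j ε = none then h ε else 0
  refine ⟨q, r, fun i => (isConvergent_iff (N := N)).2 ⟨e, ?_⟩,
    (isConvergent_iff (N := N)).2 ⟨e, ?_⟩, MvPowerSeries.ext fun δ => ?_, fun i β hi => ?_⟩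
  · refine ((_root_.Summable.comp_injective hh (add_left_injective (a i))).mul_right
      ((N.inv (a i) ^ e)⁻¹)).of_nonneg_of_le
      (fun ε => by have := N.inv_pos ε; positivity) fun ε => ?_
    have h0 := N.inv_pos (a i)
    have h1 := N.inv_pos ε
    simp only [Function.comp_apply, N.inv_add, mul_pow]
    rw [mul_assoc, mul_assoc, mul_inv_cancel₀ (by positivity), mul_one]
    refine mul_le_mul_of_nonneg_right ?_ (by positivity)
    change ‖(if _ then _ else _ : ℂ)‖ ≤ _
    split_ifs
    · exact le_rfl
    · simp
  · refine hh.of_nonneg_of_le (fun ε => by have := N.inv_pos ε; positivity) fun ε => ?_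
    refine mul_le_mul_of_nonneg_right ?_ (by have := N.inv_pos ε; positivity)
    change ‖(if _ then _ else _ : ℂ)‖ ≤ _
    split_ifs
    · exact le_rfl
    · simp
  · rw [hgh, map_add, map_sum]
    have hsplit : ∀ γ, h γ * G γ δ = (∑ i, if j γ = some i then h γ * G γ δ else 0) +
        if j γ = none then h γ * G γ δ else 0 := by
      intro γ
      rcases hγ : j γ with _ | i
      · simp
      · simp
    rw [Finset.sum_congr rfl fun γ _ => hsplit γ, Finset.sum_add_distrib, Finset.sum_comm]
    congr 1
    · refine Finset.sum_congr rfl fun i _ => ?_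
      rw [MvPowerSeries.coeff_mul]
      symm
      -- A term of the convolution `q i * f i` at `p` with `p.1 + p.2 = δ` corresponds to `γ = p.1 +
      -- a i`. The index sets match only on nonzero terms, where `p.2` has number at least that of
      -- `a i`.
      refine Finset.sum_bij_ne_zero (fun p _ _ => p.1 + a i) (fun p hp h0 => ?_)
        (fun p hp _ p' hp' _ hpp' => ?_) (fun γ hγ h0 => ?_) (fun p hp h0 => ?_)
      · have h1 : N.num (a i) ≤ N.num p.2 :=
          not_lt.1 fun hlt => right_ne_zero_of_mul h0 ((hf i).2 _ hlt)
        rw [N.mem_upTo, ← Finset.HasAntidiagonal.mem_antidiagonal.1 hp, N.num_add, N.num_add]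
        exact Nat.mul_le_mul_left _ h1
      · have h1 : p.1 = p'.1 := add_right_cancel hpp'
        have h2 := (Finset.HasAntidiagonal.mem_antidiagonal.1 hp).trans
          (Finset.HasAntidiagonal.mem_antidiagonal.1 hp').symm
        rw [h1] at h2
        exact Prod.ext h1 (add_left_cancel h2)
      · have h1 : j γ = some i := by
          by_contra hne
          exact h0 (if_neg hne)
        rw [if_pos h1, show G γ δ = _ from hPs γ δ i h1] at h0
        have h2 : γ - a i ≤ δ := by
          by_contra hne
          exact right_ne_zero_of_mul h0 (if_neg hne)
        rw [if_pos h2] at h0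
        have h3 := tsub_add_cancel_of_le (hj γ i h1)
        refine ⟨(γ - a i, δ - (γ - a i)), Finset.HasAntidiagonal.mem_antidiagonal.2
          (add_tsub_cancel_of_le h2), ?_, h3⟩
        refine ne_of_eq_of_ne ?_ h0
        change (if _ then _ else _) * _ = _
        rw [h3, if_pos h1]
      · have h1 : j (p.1 + a i) = some i := by
          by_contra hne
          exact left_ne_zero_of_mul h0 (if_neg hne)
        rw [if_pos h1, show G (p.1 + a i) δ = _ from hPs _ δ i h1, add_tsub_cancel_right,
          ← Finset.HasAntidiagonal.mem_antidiagonal.1 hp, if_pos le_self_add,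
          add_tsub_cancel_left]
        change (if _ then _ else _) * _ = _
        rw [if_pos h1]
    · rw [Finset.sum_eq_single δ]
      · change _ = if _ then _ else _
        rw [hG1, mul_one]
      · intro γ _ hne
        split_ifs with h1
        · rw [show G γ δ = _ from hPn γ δ h1, if_neg hne.symm, mul_zero]
        · rfl
      · exact fun hnot => absurd (N.mem_upTo.2 le_rfl) hnot
  · change (if _ then _ else _ : ℂ) = 0
    exact if_neg fun h0 => hj' β h0 i hi

end MonomialNumbering

/-! ### Consequences of division: `ℂ{x}` is Noetherian and closed under inverses of units. -/

theorem isConvergent_C_mul {n : ℕ} (c : ℂ) {f : MvPowerSeries (Fin n) ℂ} (hf : IsConvergent f) :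
    IsConvergent (MvPowerSeries.C c * f) := by
  have h := isConvergent_coe (MvPolynomial.C c : MvPolynomial (Fin n) ℂ)
  rw [MvPolynomial.coe_C] at h
  exact isConvergent_mul h hf

/-- The ring of convergent power series is Noetherian (Rückert's basis theorem). -/
instance isNoetherianRing_analyticRing (n : ℕ) : IsNoetherianRing (analyticRing n) := by
  classical
  obtain ⟨N⟩ := nonempty_monomialNumbering n
  refine (isNoetherianRing_iff_ideal_fg _).2 fun I => ?_
  -- Finitely many leading monomials of elements of `I` divide all others. The corresponding
  -- elements generate `I`, since the remainder of `g ∈ I` lies in `I` and a nonzero one would have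
  -- a leading monomial divisible by some `b ∈ B`.
  obtain ⟨B, hBE, hB⟩ := exists_finset_le
    {a | ∃ f : analyticRing n, f ∈ I ∧ N.Leads a (f : MvPowerSeries (Fin n) ℂ)}
  choose F hFI hF using fun b : B => hBE b.2
  refine ⟨Finset.univ.image F, le_antisymm (Ideal.span_le.2 ?_) fun g hg => ?_⟩
  · rintro _ hx
    obtain ⟨b, -, rfl⟩ := Finset.mem_image.1 (Finset.mem_coe.1 hx)
    exact hFI b
  · obtain ⟨q, r, hq, hr, hqr, h0⟩ := MonomialNumbering.exists_division hF
      (fun b => (F b).2) (g := g) g.2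
    have hg' : g = ∑ b, (⟨q b, hq b⟩ : analyticRing n) * F b + ⟨r, hr⟩ :=
      Subtype.ext (by rw [hqr]; push_cast; rfl)
    have hsum : ∑ b, (⟨q b, hq b⟩ : analyticRing n) * F b ∈ Ideal.span (Finset.univ.image F) :=
      Ideal.sum_mem _ fun b _ => Ideal.mul_mem_left _ _
        (Ideal.subset_span (Finset.mem_coe.2 (Finset.mem_image_of_mem F (Finset.mem_univ b))))
    suffices hr0 : r = 0 by
      rw [hg', show (⟨r, hr⟩ : analyticRing n) = 0 from Subtype.ext hr0, add_zero]
      exact hsum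
    by_contra hr0
    obtain ⟨a, c, hl, ha⟩ := N.exists_leads hr0
    have hrI : (⟨r, hr⟩ : analyticRing n) ∈ I := by
      rw [← sub_eq_of_eq_add' hg']
      exact I.sub_mem hg (I.sum_mem fun b _ => I.mul_mem_left _ (hFI b))
    obtain ⟨b, hb, hba⟩ := hB a ⟨⟨_, isConvergent_C_mul c hr⟩, by
      have h := isConvergent_coe (MvPolynomial.C c : MvPolynomial (Fin n) ℂ)
      rw [MvPolynomial.coe_C] at h
      exact I.mul_mem_left ⟨MvPowerSeries.C c, h⟩ hrI, hl⟩
    exact ha (h0 ⟨b, hb⟩ a hba)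

/-- The inverse of a convergent power series with nonzero constant coefficient converges. -/
theorem inv_mem_analyticRing {n : ℕ} {f : MvPowerSeries (Fin n) ℂ} (hf : f ∈ analyticRing n)
    (h0 : MvPowerSeries.constantCoeff f ≠ 0) : f⁻¹ ∈ analyticRing n := by
  obtain ⟨N⟩ := nonempty_monomialNumbering n
  set c := MvPowerSeries.constantCoeff f with hc
  have hl : N.Leads 0 (MvPowerSeries.C c⁻¹ * f) := by
    refine ⟨?_, fun β hβ => absurd (N.one_le β) (not_le.2 (hβ.trans_le ?_))⟩
    · rw [MvPowerSeries.coeff_C_mul, MvPowerSeries.coeff_zero_eq_constantCoeff_apply, ← hc,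
        inv_mul_cancel₀ h0]
    · have := N.num_add 0 0
      rw [add_zero] at this
      exact (Nat.eq_of_mul_eq_mul_left (N.one_le 0) ((mul_one _).trans this)).ge
  -- Dividing `1` by a series with leading monomial `1` leaves no remainder, because `1` divides
  -- every monomial; the quotient is the convergent inverse.
  obtain ⟨q, r, hq, -, hqr, hr⟩ := MonomialNumbering.exists_division (ι := Unit)
    (a := fun _ => 0) (f := fun _ => MvPowerSeries.C c⁻¹ * f) (fun _ => hl)
    (fun _ => isConvergent_C_mul _ hf) (g := 1) (analyticRing n).one_mem
  have hr0 : r = 0 := MvPowerSeries.ext fun β => hr () β zero_le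
  simp only [hr0, add_zero, Finset.univ_unique, Finset.sum_singleton] at hqr
  have : f⁻¹ = MvPowerSeries.C c⁻¹ * q default := by
    rw [MvPowerSeries.inv_eq_iff_mul_eq_one h0, hqr]
    ring
  rw [this]
  exact isConvergent_C_mul _ (hq _)

/-! ### Monomial division and flatness of extensions of power series rings. -/

section flatness

variable {k : Type*} [Field k] {n : ℕ}

theorem monomial_mem_polynomialRing (β : Fin n →₀ ℕ) (c : k) :
    MvPowerSeries.monomial β c ∈ polynomialRing k n :=
  ⟨MvPolynomial.monomial β c, MvPolynomial.coe_monomial _ _⟩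

/-- The quotient of `f` by `x^m`, the monomials not divisible by `x^m` being dropped. -/
noncomputable def shift (m : Fin n →₀ ℕ) (f : MvPowerSeries (Fin n) k) : MvPowerSeries (Fin n) k :=
  fun ε => MvPowerSeries.coeff (ε + m) f

theorem coeff_shift (m ε : Fin n →₀ ℕ) (f : MvPowerSeries (Fin n) k) :
    MvPowerSeries.coeff ε (shift m f) = MvPowerSeries.coeff (ε + m) f := rfl

/-- An element of `S` all of whose monomials are divisible by one of finitely many monomials is a
combination of these monomials with coefficients in `S`. -/
def HasMonomialDivision (S : Subring (MvPowerSeries (Fin n) k)) : Prop :=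
  ∀ (B : Finset (Fin n →₀ ℕ)) (f : MvPowerSeries (Fin n) k), f ∈ S →
    (∀ α, MvPowerSeries.coeff α f ≠ 0 → ∃ m ∈ B, m ≤ α) →
    ∃ d : (Fin n →₀ ℕ) → MvPowerSeries (Fin n) k, (∀ m, d m ∈ S) ∧
      f = ∑ m ∈ B, d m * MvPowerSeries.monomial m 1

/-- The monomials are removed from `B` one at a time: subtracting `shift m f * x^m` deletes exactly
the terms of `f` divisible by `x^m`, and the remaining terms are divisible by other elements of `B`.
-/
theorem HasMonomialDivision.of_shift {S : Subring (MvPowerSeries (Fin n) k)}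
    (hS : polynomialRing k n ≤ S) (h : ∀ m, ∀ f ∈ S, shift m f ∈ S) : HasMonomialDivision S := by
  classical
  intro B
  induction B using Finset.induction_on with
  | empty =>
    intro f _ hB
    refine ⟨fun _ => 0, fun _ => S.zero_mem, MvPowerSeries.ext fun α => ?_⟩
    by_contra hα
    obtain ⟨m, hm, -⟩ := hB α (by simpa using hα)
    simp at hm
  | insert m B hm ih =>
    intro f hf hB
    have hcoeff : ∀ α, MvPowerSeries.coeff α (f - shift m f * MvPowerSeries.monomial m 1) =
        if m ≤ α then 0 else MvPowerSeries.coeff α f := fun α => by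
      rw [map_sub, MvPowerSeries.coeff_mul_monomial]
      split_ifs with hle
      · rw [coeff_shift, tsub_add_cancel_of_le hle, mul_one, sub_self]
      · rw [sub_zero]
    obtain ⟨d, hd, hfd⟩ := ih (f - shift m f * MvPowerSeries.monomial m 1)
      (S.sub_mem hf (S.mul_mem (h m f hf) (hS (monomial_mem_polynomialRing m 1)))) fun α hα => by
        rw [hcoeff] at hα
        split_ifs at hα with hle
        · exact absurd rfl hα
        · obtain ⟨b, hb, hba⟩ := hB α hα
          rcases Finset.mem_insert.1 hb with rfl | hb
          · exact absurd hba hle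
          · exact ⟨b, hb, hba⟩
    refine ⟨Function.update d m (shift m f), fun b => ?_, ?_⟩
    · rcases eq_or_ne b m with rfl | hb
      · simpa using h b f hf
      · simpa [hb] using hd b
    · rw [Finset.sum_insert hm, Function.update_self, ← sub_eq_iff_eq_add', hfd]
      refine Finset.sum_congr rfl fun b hb => ?_
      rw [Function.update_of_ne (fun h0 : b = m => hm (h0 ▸ hb))]

theorem hasMonomialDivision_top : HasMonomialDivision (⊤ : Subring (MvPowerSeries (Fin n) k)) :=
  .of_shift le_top fun _ _ _ => trivial

theorem hasMonomialDivision_polynomialRing : HasMonomialDivision (polynomialRing k n) := by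
  refine .of_shift le_rfl ?_
  rintro m _ ⟨p, rfl⟩
  -- Shifting does not raise the total degree, so truncation beyond degree `p.totalDegree` changes
  -- nothing and exhibits the shift as a polynomial.
  refine ⟨MvPowerSeries.truncTotal (p.totalDegree + 1) (shift m (p : MvPowerSeries (Fin n) k)),
    MvPowerSeries.ext fun ε => ?_⟩
  rw [MvPolynomial.coeToMvPowerSeries.ringHom_apply, MvPolynomial.coeff_coe,
    MvPowerSeries.coeff_truncTotal_eq_ite]
  split_ifs with h
  · rfl
  · rw [coeff_shift, MvPolynomial.coeToMvPowerSeries.ringHom_apply, MvPolynomial.coeff_coe]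
    refine (MvPolynomial.coeff_eq_zero_of_totalDegree_lt ?_).symm
    change _ < Finsupp.degree (ε + m)
    rw [map_add]
    omega

theorem polynomialRing_le_analyticRing : polynomialRing ℂ n ≤ analyticRing n :=
  polynomialRing_le_localRing.trans localRing_le_analyticRing

theorem hasMonomialDivision_analyticRing : HasMonomialDivision (analyticRing n) := by
  refine .of_shift polynomialRing_le_analyticRing ?_
  rintro m f ⟨r, hr, h⟩
  refine ⟨r, hr, ((h.comp_injective (add_left_injective m)).mul_right
    ((r ^ m.degree)⁻¹)).congr fun ε => ?_⟩
  simp only [Function.comp_apply, coeff_shift, map_add, pow_add]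
  field_simp

/-- The ideal generated by the variables. -/
noncomputable def variableIdeal {R : Subring (MvPowerSeries (Fin n) k)}
    (hR : polynomialRing k n ≤ R) : Ideal R :=
  Ideal.span (Set.range fun i : Fin n =>
    ⟨MvPowerSeries.X i, hR (monomial_mem_polynomialRing (Finsupp.single i 1) 1)⟩)

theorem monomial_mem_variableIdeal_pow {R : Subring (MvPowerSeries (Fin n) k)}
    (hR : polynomialRing k n ≤ R) (β : Fin n →₀ ℕ) :
    (⟨MvPowerSeries.monomial β 1, hR (monomial_mem_polynomialRing β 1)⟩ : R) ∈
      variableIdeal hR ^ β.degree := by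
  induction β using Finsupp.induction_linear with
  | zero => simp
  | add β γ hβ hγ =>
    rw [map_add, pow_add]
    convert Ideal.mul_mem_mul hβ hγ using 1
    refine Subtype.ext ?_
    change _ = MvPowerSeries.monomial β 1 * MvPowerSeries.monomial γ 1
    rw [MvPowerSeries.monomial_mul_monomial, mul_one]
  | single i a =>
    rw [Finsupp.degree_single]
    have h : (⟨MvPowerSeries.X i, hR (monomial_mem_polynomialRing (Finsupp.single i 1) 1)⟩ : R) ∈
        variableIdeal hR := Ideal.subset_span (Set.mem_range_self i)
    convert Ideal.pow_mem_pow h a using 1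
    refine Subtype.ext ?_
    change _ = MvPowerSeries.X i ^ a
    rw [MvPowerSeries.X_pow_eq]

/-- Identifies the adic filtration of `R` with the filtration by degree. Elements of the `N`-th
power have order at least `N` because orders add under products. Conversely, Dickson's lemma gives
finitely many monomials of degree at least `N` dividing all the others, and monomial division writes
`a` in terms of them with coefficients in `R`. -/
theorem mem_variableIdeal_pow {R : Subring (MvPowerSeries (Fin n) k)}
    (hR : polynomialRing k n ≤ R) (hd : HasMonomialDivision R) (N : ℕ) (a : R) :
    a ∈ variableIdeal hR ^ N ↔
      ∀ α : Fin n →₀ ℕ, α.degree < N → MvPowerSeries.coeff α (a : MvPowerSeries (Fin n) k) = 0 := by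
  constructor
  · intro ha α hα
    refine MvPowerSeries.coeff_of_lt_order (lt_of_lt_of_le (Nat.cast_lt.2 hα) ?_)
    induction N generalizing a α with
    | zero => simp
    | succ N ih =>
      rw [pow_succ] at ha
      refine Submodule.mul_induction_on ha (fun b hb c hc => ?_) fun b c hb hc =>
        le_trans (le_min hb hc) MvPowerSeries.min_order_le_add
      refine le_trans ?_ MvPowerSeries.le_order_mul
      push_cast
      refine add_le_add ?_ ?_
      -- The induction hypothesis asks for some exponent of degree below `N`; `0` serves when `N` is
      -- positive, and for `N = 0` the bound is trivial.
      · rcases N with _ | N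
        · simp
        · exact ih b hb 0 (by simp)
      · refine Submodule.span_induction ?_ (by simp) (fun b c _ _ hb hc =>
          le_trans (le_min hb hc) MvPowerSeries.min_order_le_add)
          (fun b c _ hc => le_trans (le_trans hc le_add_self) MvPowerSeries.le_order_mul) hc
        rintro _ ⟨i, rfl⟩
        rw [MvPowerSeries.one_le_order_iff_constCoeff_eq_zero]
        simp
  · intro h
    obtain ⟨B, hB, hB'⟩ := exists_finset_le {α : Fin n →₀ ℕ | N ≤ α.degree}
    obtain ⟨d, hdR, had⟩ := hd B a a.2 fun α hα =>
      hB' α (not_lt.1 fun hlt => hα (h α hlt))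
    have : a = ∑ m ∈ B, (⟨d m, hdR m⟩ : R) *
        ⟨MvPowerSeries.monomial m 1, hR (monomial_mem_polynomialRing m 1)⟩ :=
      Subtype.ext (by rw [had]; push_cast; rfl)
    rw [this]
    exact Ideal.sum_mem _ fun m hm => Ideal.mul_mem_left _ _
      (Ideal.pow_le_pow_right (hB hm) (monomial_mem_variableIdeal_pow hR m))

/-- Formal power series form a flat module over a Noetherian ring of power series which contains
the polynomials and admits division by monomials. -/
theorem flat_powerSeries {R : Subring (MvPowerSeries (Fin n) k)} [IsNoetherianRing R]
    (hR : polynomialRing k n ≤ R) (hd : HasMonomialDivision R) :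
    Module.Flat R (MvPowerSeries (Fin n) k) := by
  set m := variableIdeal hR with hm
  have hmem : ∀ (N : ℕ) (a : R), a ∈ (m ^ N • ⊤ : Submodule R R) ↔ ∀ α : Fin n →₀ ℕ,
      α.degree < N → MvPowerSeries.coeff α (a : MvPowerSeries (Fin n) k) = 0 := fun N a => by
    rw [smul_eq_mul, Ideal.mul_top]
    exact mem_variableIdeal_pow hR hd N a
  let tr : ℕ → MvPowerSeries (Fin n) k → R := fun N f =>
    ⟨(MvPowerSeries.truncTotal N f : MvPolynomial (Fin n) k), hR ⟨_, rfl⟩⟩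
  have htr : ∀ (N : ℕ) f (α : Fin n →₀ ℕ), α.degree < N →
      MvPowerSeries.coeff α (tr N f : MvPowerSeries (Fin n) k) = MvPowerSeries.coeff α f :=
    fun N f α hα => by
      simp only [tr, MvPolynomial.coeff_coe, MvPowerSeries.coeff_truncTotal f hα]
  have hext : ∀ (N : ℕ) (a b : R), (∀ α : Fin n →₀ ℕ, α.degree < N →
      MvPowerSeries.coeff α (a : MvPowerSeries (Fin n) k) =
        MvPowerSeries.coeff α (b : MvPowerSeries (Fin n) k)) ↔
      Submodule.Quotient.mk (p := (m ^ N • ⊤ : Submodule R R)) a = Submodule.Quotient.mk b := by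
    intro N a b
    rw [Submodule.Quotient.eq, hmem]
    refine forall₂_congr fun α _ => ?_
    push_cast
    rw [map_sub, sub_eq_zero]
  -- A formal series is sent to its compatible system of truncations. By `hext`, congruence modulo
  -- `m ^ N` is agreement of the coefficients in degrees below `N`, so `φ` identifies `k[[x]]` with
  -- the `m`-adic completion, which is flat because `R` is Noetherian.
  let φ : MvPowerSeries (Fin n) k →ₗ[R] AdicCompletion m R := AdicCompletion.lift m
    (fun N =>
      { toFun := fun f => Submodule.Quotient.mk (tr N f)
        map_add' := fun f g => (hext N _ (tr N f + tr N g)).1 fun α hα => by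
          push_cast
          rw [map_add, htr N _ α hα, htr N _ α hα, htr N _ α hα, map_add]
        map_smul' := fun c f => (hext N _ (c • tr N f)).1 fun α hα => by
          rw [htr N _ α hα]
          change MvPowerSeries.coeff α ((c : MvPowerSeries (Fin n) k) * f) =
            MvPowerSeries.coeff α ((c : MvPowerSeries (Fin n) k) * (tr N f : MvPowerSeries (Fin n) k))
          rw [MvPowerSeries.coeff_mul, MvPowerSeries.coeff_mul]
          refine Finset.sum_congr rfl fun p hp => ?_
          rw [htr N]
          rw [← Finset.HasAntidiagonal.mem_antidiagonal.1 hp, map_add] at hα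
          omega })
    fun {M N} hle => LinearMap.ext fun f => (hext M _ (tr M f)).1 fun α hα => by
      exact (htr N f α (hα.trans_le hle)).trans (htr M f α hα).symm
  have hφ : ∀ f N, (φ f).val N = Submodule.Quotient.mk (tr N f) := fun _ _ => rfl
  have hbij : Function.Bijective φ := by
    constructor
    · intro f g hfg
      refine MvPowerSeries.ext fun α => ?_
      have h1 : (φ f).val (α.degree + 1) = (φ g).val (α.degree + 1) := by rw [hfg]
      rw [hφ, hφ] at h1
      have h2 := (hext _ _ _).2 h1 α (Nat.lt_succ_self _)
      rwa [htr _ _ α (Nat.lt_succ_self _), htr _ _ α (Nat.lt_succ_self _)] at h2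
    · intro x
      obtain ⟨a, rfl⟩ := AdicCompletion.mk_surjective m R x
      -- The coefficient at `α` is constant along the Cauchy sequence from index `α.degree + 1` on,
      -- the first one that determines it.
      refine ⟨fun α => MvPowerSeries.coeff α (a (α.degree + 1) : MvPowerSeries (Fin n) k),
        AdicCompletion.ext fun N => ?_⟩
      refine (hφ _ _).trans ((hext N _ (a N)).1 fun α hα => ?_)
      refine (htr N _ α hα).trans ?_
      exact ((hext _ _ _).2 (AdicCompletion.AdicCauchySequence.mk_eq_mk (Nat.succ_le_of_lt hα) a) α
        (Nat.lt_succ_self _)).symm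
  exact (Module.Flat.equiv_iff (LinearEquiv.ofBijective φ hbij)).2 inferInstance

/-- Every solution in `R'` of a finite system of homogeneous linear equations over `R` is a
combination, with coefficients in `R'`, of solutions in `R`. -/
def LinearlyFlat (R R' : Subring (MvPowerSeries (Fin n) k)) : Prop :=
  ∀ (σ τ : Type) [Fintype σ] [Fintype τ] (M : σ → τ → MvPowerSeries (Fin n) k),
    (∀ i j, M i j ∈ R) → ∀ y : τ → MvPowerSeries (Fin n) k, (∀ j, y j ∈ R') →
    (∀ i, ∑ j, M i j * y j = 0) →
    ∃ (L : ℕ) (c : Fin L → MvPowerSeries (Fin n) k) (s : Fin L → τ → MvPowerSeries (Fin n) k),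
      (∀ l, c l ∈ R') ∧ (∀ l j, s l j ∈ R) ∧ (∀ l i, ∑ j, M i j * s l j = 0) ∧
      ∀ j, y j = ∑ l, c l * s l j

/-- The equational criterion for flatness. The rows of `M` span the image of `f : R^σ → R^τ`, and a
solution `y` is a map `x : R^τ → k[[x]]` that kills it. Flatness factors `x` through a finite free
module by a map `a` that still kills the image of `f`; the components of `a` are the solutions over
`R`, and the images of the basis vectors are the coefficients. -/
theorem LinearlyFlat.of_flat {R : Subring (MvPowerSeries (Fin n) k)}
    (h : Module.Flat R (MvPowerSeries (Fin n) k)) : LinearlyFlat R ⊤ := by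
  classical
  intro σ τ _ _ M hM y _ hy
  let M' : σ → τ → R := fun i j => ⟨M i j, hM i j⟩
  let f : (σ → R) →ₗ[R] (τ → R) := Fintype.linearCombination R M'
  let x : (τ → R) →ₗ[R] MvPowerSeries (Fin n) k := Fintype.linearCombination R y
  have hf : ∀ i, f (Pi.single i 1) = M' i := fun i => by
    simp [f, Fintype.linearCombination_apply_single]
  have hxf : x ∘ₗ f = 0 := by
    refine LinearMap.pi_ext' fun i => LinearMap.ext_ring ?_
    change x (f (Pi.single i 1)) = 0
    rw [hf]
    exact (Fintype.linearCombination_apply R y _).trans (hy i)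
  obtain ⟨L, a, z, hxz, haf⟩ := Module.Flat.exists_factorization_of_comp_eq_zero_of_free hxf
  refine ⟨L, fun l => z (Finsupp.single l 1), fun l j => (a (Pi.single j 1) l : R),
    fun _ => trivial, fun l j => SetLike.coe_mem _, fun l i => ?_, fun j => ?_⟩
  · have h1 : a (M' i) = 0 := by
      rw [← hf]
      exact LinearMap.congr_fun haf (Pi.single i 1)
    have h2 : M' i = ∑ j, M' i j • Pi.single j (1 : R) := by
      ext j
      simp [Finset.sum_apply, Pi.single_apply]
    have h3 : ∑ j, M' i j * a (Pi.single j 1) l = 0 := by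
      have h4 := DFunLike.congr_fun h1 l
      rw [h2, map_sum] at h4
      simpa using h4
    have h4 := congrArg (Subtype.val) h3
    push_cast at h4
    exact h4
  · have h1 : y j = x (Pi.single j 1) := by
      simp [x, Fintype.linearCombination_apply_single]
    have h2 : a (Pi.single j 1) = ∑ l, (a (Pi.single j 1) l) • Finsupp.single l (1 : R) := by
      ext l
      simp
    rw [h1, hxz, LinearMap.comp_apply]
    conv_lhs => rw [h2, map_sum]
    refine Finset.sum_congr rfl fun l _ => ?_
    rw [map_smul, mul_comm]
    rfl

theorem linearlyFlat_polynomialRing_top : LinearlyFlat (polynomialRing k n) ⊤ :=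
  haveI : IsNoetherianRing (polynomialRing k n) := by
    unfold polynomialRing; infer_instance
  .of_flat (flat_powerSeries le_rfl hasMonomialDivision_polynomialRing)

theorem linearlyFlat_analyticRing_top : LinearlyFlat (analyticRing n) ⊤ :=
  .of_flat (flat_powerSeries polynomialRing_le_analyticRing hasMonomialDivision_analyticRing)

theorem constantCoeff_coe (p : MvPolynomial (Fin n) k) :
    MvPowerSeries.constantCoeff (p : MvPowerSeries (Fin n) k) = MvPolynomial.constantCoeff p := by
  rw [← MvPowerSeries.coeff_zero_eq_constantCoeff_apply, MvPolynomial.coeff_coe,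
    MvPolynomial.constantCoeff_eq]

theorem inv_mem_localRing {q : MvPowerSeries (Fin n) k} (hq : q ∈ polynomialRing k n)
    (h0 : MvPowerSeries.constantCoeff q ≠ 0) : q⁻¹ ∈ localRing k n := by
  obtain ⟨p, rfl⟩ := hq
  refine ⟨1, p, ?_, ?_⟩
  · rwa [MvPolynomial.coeToMvPowerSeries.ringHom_apply, constantCoeff_coe] at h0
  · simpa using MvPowerSeries.inv_mul_cancel _ h0

/-- Finitely many elements of the local ring have a common denominator. -/
theorem exists_common_denominator {τ : Type*} [Fintype τ] {y : τ → MvPowerSeries (Fin n) k}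
    (hy : ∀ j, y j ∈ localRing k n) :
    ∃ q ∈ polynomialRing k n, MvPowerSeries.constantCoeff q ≠ 0 ∧
      ∀ j, q * y j ∈ polynomialRing k n := by
  classical
  choose p q hq h using hy
  refine ⟨∏ j, (q j : MvPowerSeries (Fin n) k), Subring.prod_mem _ fun j _ => ⟨q j, rfl⟩, ?_,
    fun j => ?_⟩
  · rw [map_prod]
    exact Finset.prod_ne_zero_iff.2 fun j _ => by
      rw [constantCoeff_coe]; exact hq j
  · rw [← Finset.prod_erase_mul _ _ (Finset.mem_univ j), mul_assoc, mul_comm _ (y j), h]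
    exact Subring.mul_mem _ (Subring.prod_mem _ fun j _ => ⟨q j, rfl⟩) ⟨p j, rfl⟩

/-- A common denominator `q` turns `y` into the polynomial solution `q * y`, and `q⁻¹` is the single
coefficient needed. -/
theorem linearlyFlat_polynomialRing_localRing :
    LinearlyFlat (polynomialRing k n) (localRing k n) := by
  intro σ τ _ _ M hM y hy h
  obtain ⟨q, hq, hq0, hqy⟩ := exists_common_denominator hy
  refine ⟨1, fun _ => q⁻¹, fun _ j => q * y j, fun _ => inv_mem_localRing hq hq0,
    fun _ j => hqy j, fun _ i => ?_, fun j => ?_⟩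
  · simp only [mul_left_comm _ q, ← Finset.mul_sum, h, mul_zero]
  · simp [← mul_assoc, MvPowerSeries.inv_mul_cancel _ hq0]

/-- Multiplying the system by a common denominator makes it polynomial without changing its
solutions, since power series form a domain. -/
theorem linearlyFlat_localRing_top : LinearlyFlat (localRing k n) ⊤ := by
  intro σ τ _ _ M hM y hy h
  obtain ⟨q, hq, hq0, hqM⟩ := exists_common_denominator (τ := σ × τ) (y := fun p => M p.1 p.2)
    fun p => hM p.1 p.2
  have hq' : q ≠ 0 := fun h0 => hq0 (by rw [h0, map_zero])
  obtain ⟨L, c, s, hc, hs, hMs, hys⟩ := linearlyFlat_polynomialRing_top σ τ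
    (fun i j => q * M i j) (fun i j => hqM (i, j)) y hy fun i => by
      simp only [mul_assoc, ← Finset.mul_sum, h, mul_zero]
  refine ⟨L, c, s, hc, fun l j => polynomialRing_le_localRing (hs l j), fun l i => ?_, hys⟩
  have h1 := hMs l i
  simp only [mul_assoc, ← Finset.mul_sum] at h1
  exact (mul_eq_zero.1 h1).resolve_left hq'

/-- Descent of flatness from `k[[x]]` to a local ring `R'` over which `k[[x]]` is flat. -/
theorem LinearlyFlat.descend {R R' : Subring (MvPowerSeries (Fin n) k)} (hRR' : R ≤ R')
    (h : LinearlyFlat R ⊤) (h' : LinearlyFlat R' ⊤)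
    (hinv : ∀ f ∈ R', MvPowerSeries.constantCoeff f ≠ 0 → f⁻¹ ∈ R') : LinearlyFlat R R' := by
  intro σ τ _ _ M hM y hy hMy
  obtain ⟨L, c, s, -, hs, hMs, hys⟩ := h σ τ M hM y (fun _ => trivial) hMy
  -- The expression `y = ∑ c_l s_l` has coefficients only in `k[[x]]`. It says that the vector `(1,
  -- c)` solves the system `y_j X_none - ∑ s_lj X_l = 0` over `R'`, so this vector is a combination
  -- of solutions `z p` with entries in `R'`.
  obtain ⟨K, e, z, -, hz, hMz, hez⟩ := h' τ (Option (Fin L))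
    (fun j o => o.elim (y j) fun l => -s l j)
    (fun j o => by
      rcases o with _ | l
      · exact hy j
      · exact R'.neg_mem (hRR' (hs l j)))
    (fun o => o.elim 1 c) (fun _ => trivial) fun j => by
      rw [Fintype.sum_option]
      simp [hys j, mul_comm]
  -- The entry at `none` reads `1 = ∑ e_p z_p(none)`, so some `z p none` has nonzero constant term
  -- and is a unit of `R'`. Dividing by it gives coefficients in `R'` with the same `s`.
  obtain ⟨p, hp⟩ : ∃ p, MvPowerSeries.constantCoeff (z p none) ≠ 0 := by
    by_contra! h0
    have h1 := congrArg MvPowerSeries.constantCoeff (hez none)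
    simp [h0] at h1
  refine ⟨L, fun l => (z p none)⁻¹ * z p (some l), s,
    fun l => R'.mul_mem (hinv _ (hz p none) hp) (hz p _), hs, hMs, fun j => ?_⟩
  have h1 := hMz p j
  rw [Fintype.sum_option] at h1
  simp only [Option.elim_none, Option.elim_some, neg_mul, Finset.sum_neg_distrib] at h1
  have h2 : y j * z p none = ∑ l, s l j * z p (some l) := by linear_combination h1
  calc y j = y j * z p none * (z p none)⁻¹ := by
        rw [mul_assoc, MvPowerSeries.mul_inv_cancel _ hp, mul_one]
    _ = _ := by
        rw [h2, Finset.sum_mul]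
        exact Finset.sum_congr rfl fun l _ => by ring

theorem linearlyFlat_localRing_analyticRing : LinearlyFlat (localRing ℂ n) (analyticRing n) :=
  .descend localRing_le_analyticRing linearlyFlat_localRing_top linearlyFlat_analyticRing_top
    fun _ => inv_mem_analyticRing

/-- Clearing the denominator reduces to polynomials: monomials of `q * f` are multiples of monomials
of `f`, so they stay divisible by elements of `B`. -/
theorem hasMonomialDivision_localRing : HasMonomialDivision (localRing k n) := by
  classical
  intro B f hf hB
  obtain ⟨q, hq, hq0, hqf⟩ := exists_common_denominator (τ := Unit) fun _ => hf
  obtain ⟨d, hd, hfd⟩ := hasMonomialDivision_polynomialRing B (q * f) (hqf ()) fun α hα => by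
    rw [MvPowerSeries.coeff_mul] at hα
    obtain ⟨p, hp, h⟩ := Finset.exists_ne_zero_of_sum_ne_zero hα
    obtain ⟨m, hm, hle⟩ := hB p.2 (right_ne_zero_of_mul h)
    exact ⟨m, hm, hle.trans (Finset.HasAntidiagonal.mem_antidiagonal.1 hp ▸ le_add_self)⟩
  refine ⟨fun m => q⁻¹ * d m, fun m => Subring.mul_mem _ (inv_mem_localRing hq hq0)
    (polynomialRing_le_localRing (hd m)), ?_⟩
  simp only [mul_assoc, ← Finset.mul_sum, ← hfd]
  rw [← mul_assoc, MvPowerSeries.inv_mul_cancel _ hq0, one_mul]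

end flatness
-- Symbols and coefficients in the associated graded ring.
namespace Weighting

variable {A ι k : Type*} [Ring A] [Field k] (F : Weighting A ι k)

/-- Removes the requirement that the order be exactly `t`: below it the symbol in degree `t` is
zero. Elements produced by flatness satisfy only an upper bound on their order. -/
theorem symbol_mem_initialIdeal {I : Ideal A} {t : ℝ} (f : F.le t) (hf : (f : A) ∈ I) :
    F.symbol t f ∈ F.initialIdeal I := by
  by_cases h : (f : A) ∈ F.lt t
  · have h0 : F.symbol t f = 0 := by
      rw [symbol, AddMonoidHom.comp_apply, (F.piece_eq_zero f).2 h, map_zero]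
    rw [h0]
    exact Ideal.zero_mem _
  · exact Ideal.subset_span ⟨t, f, hf, h, rfl⟩

theorem symbol_zero_mul {t : ℝ} (f : F.le 0) (g : F.le t) (h : (f : A) * g ∈ F.le t) :
    F.symbol 0 f * F.symbol t g = F.symbol t ⟨f * g, h⟩ := by
  refine (DirectSum.of_mul_of _ _).trans ?_
  exact DirectSum.of_eq_of_gradedMonoid_eq (F.mk_piece_congr (zero_add t)
    ⟨f * g, F.mul_mem_le f.2 g.2⟩ ⟨f * g, h⟩ rfl)

/-- Pieces of different degrees have coefficients at disjoint sets of monomials. The coefficient at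
a monomial of weight `t` thus sees only the component of degree `t`, and a representative whose
coefficients of weight `t` all vanish has order below `t`. -/
theorem grCoeff_injective : Function.Injective F.grCoeff := by
  classical
  rw [injective_iff_map_eq_zero]
  intro s hs
  refine DFinsupp.ext fun t => ?_
  obtain ⟨f, hf⟩ := F.piece_surjective t (s t)
  rw [DFinsupp.zero_apply]
  refine hf.symm.trans ((F.piece_eq_zero f).2 fun i hi => lt_of_le_of_ne (f.2 i hi) fun hw => hi ?_)
  have key : ∀ s' : F.Gr, ∀ f : F.le t, F.piece t f = s' t → F.grCoeff s' i = F.coeff f i := by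
    intro s'
    induction s' using DirectSum.induction_on with
    | zero =>
      intro f hf
      by_contra h
      rw [map_zero] at h
      exact ((F.piece_eq_zero f).1 hf i (Ne.symm h)).ne hw
    | of r x =>
      intro f hf
      obtain ⟨g, rfl⟩ := F.piece_surjective r x
      have h1 := congrFun (F.grCoeff_symbol r g) i
      refine h1.trans ?_
      rcases eq_or_ne r t with rfl | hrt
      · rw [Set.indicator_of_mem (by exact hw), ← sub_eq_zero, ← Pi.sub_apply, ← map_sub]
        rw [DirectSum.of_eq_same, ← sub_eq_zero, ← map_sub, F.piece_eq_zero] at hf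
        by_contra h
        refine (hf i ?_).ne hw
        intro h0
        refine h ?_
        rw [← neg_sub, map_neg, Pi.neg_apply]
        exact neg_eq_zero.2 h0
      · rw [Set.indicator_of_notMem (fun h => hrt (h.symm.trans hw))]
        rw [DirectSum.of_eq_of_ne _ _ _ hrt.symm] at hf
        by_contra h
        exact ((F.piece_eq_zero f).1 hf i (Ne.symm h)).ne hw
    | add x y hx hy =>
      intro f hf
      obtain ⟨g, hg⟩ := F.piece_surjective t (x t)
      have h1 : F.piece t (f - g) = y t := by
        rw [map_sub, hf, hg, DirectSum.add_apply, add_sub_cancel_left]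
      rw [map_add, Pi.add_apply, hx g hg, hy _ h1, ← Pi.add_apply, ← map_add,
        ← AddSubgroup.coe_add, add_sub_cancel]
  rw [← key s f hf, hs]
  rfl

theorem grCoeff_grInclusion {R R' : Subring A} (h : R ≤ R') (s : (F.restrict R).Gr) :
    (F.restrict R').grCoeff (F.grInclusion h s) = (F.restrict R).grCoeff s := by
  induction s using DirectSum.induction_on with
  | zero => simp
  | of t x =>
    obtain ⟨f, rfl⟩ := (F.restrict R).piece_surjective t x
    change (F.restrict R').grCoeff (F.grInclusion h ((F.restrict R).symbol t f)) =
      (F.restrict R).grCoeff ((F.restrict R).symbol t f)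
    rw [F.grInclusion_symbol, grCoeff_symbol, grCoeff_symbol]
    rfl
  | add x y hx hy => rw [map_add, map_add, map_add, hx, hy]

end Weighting

/-! ### Formal reductions for initial ideals and fans. -/

section extension

variable {A ι k W : Type*} [Ring A] [Field k]

/-- The initial ideal extends if every element of order at most `t` of an extended ideal is a
combination of elements of the ideal of order at most `t` with coefficients of order at
most `0`. -/
theorem InitialIdealExtends.of_closure {F : Weighting A ι k} {R R' : Subring A} {h : R ≤ R'}
    (H : ∀ (I : Ideal R) (t : ℝ), ∀ P ∈ Ideal.map (Subring.inclusion h) I, (P : A) ∈ F.le t →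
      (P : A) ∈ AddSubgroup.closure {x | ∃ c ∈ R', c ∈ F.le 0 ∧
        ∃ g ∈ I, (g : A) ∈ F.le t ∧ x = c * g}) : InitialIdealExtends F R R' h := by
  intro I
  refine le_antisymm ?_ (Ideal.span_le.2 ?_)
  · rw [Ideal.map_le_iff_le_comap]
    refine Ideal.span_le.2 ?_
    rintro _ ⟨t, f, hf, -, rfl⟩
    rw [SetLike.mem_coe, Ideal.mem_comap, F.grInclusion_symbol]
    exact Weighting.symbol_mem_initialIdeal _ _ (Ideal.mem_map_of_mem (Subring.inclusion h) hf)
  · rintro _ ⟨t, P, hP, -, rfl⟩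
    -- The symbol in degree `t` is additive on all of `F_t`, so membership can be checked on the
    -- generators `c * g`, whose symbol is the product of the symbols of `c` in degree `0` and `g`
    -- in degree `t`.
    suffices key : ∀ x ∈ AddSubgroup.closure {x : A | ∃ c ∈ R', c ∈ F.le 0 ∧
        ∃ g ∈ I, (g : A) ∈ F.le t ∧ x = c * g}, ∃ Q : (F.restrict R').le t, ((Q : R') : A) = x ∧
          (F.restrict R').symbol t Q ∈
            Ideal.map (F.grInclusion h) ((F.restrict R).initialIdeal I) by
      obtain ⟨Q, hQ, hmem⟩ := key _ (H I t P hP P.2)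
      rwa [show Q = P from Subtype.ext (Subtype.ext hQ)] at hmem
    intro x hx
    induction hx using AddSubgroup.closure_induction with
    | mem x hx =>
      obtain ⟨c, hc, hc0, g, hg, hgt, rfl⟩ := hx
      have hcg : c * (g : A) ∈ F.le t := by
        simpa using F.mul_mem_le hc0 hgt
      refine ⟨⟨⟨c * g, R'.mul_mem hc (h g.2)⟩, hcg⟩, rfl, ?_⟩
      have h1 := (F.restrict R').symbol_zero_mul ⟨⟨c, hc⟩, hc0⟩
        (⟨Subring.inclusion h g, hgt⟩ : (F.restrict R').le t) hcg
      have h2 := F.grInclusion_symbol h t ⟨g, hgt⟩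
      refine (congrArg (· ∈ Ideal.map (F.grInclusion h) ((F.restrict R).initialIdeal I)) h1).mp ?_
      rw [← h2]
      exact Ideal.mul_mem_left _ _ (Ideal.mem_map_of_mem _
        ((F.restrict R).symbol_mem_initialIdeal ⟨g, hgt⟩ hg))
    | zero => exact ⟨0, rfl, by rw [map_zero]; exact Ideal.zero_mem _⟩
    | add x y _ _ hx hy =>
      obtain ⟨Q, rfl, hQ⟩ := hx
      obtain ⟨Q', rfl, hQ'⟩ := hy
      exact ⟨Q + Q', rfl, by rw [map_add]; exact Ideal.add_mem _ hQ hQ'⟩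
    | neg x _ hx =>
      obtain ⟨Q, rfl, hQ⟩ := hx
      refine ⟨-Q, rfl, ?_⟩
      rw [← neg_one_zsmul, map_zsmul]
      exact zsmul_mem hQ _

/-- If initial ideals extend from `R` to `R'`, then so do open Gröbner fans. -/
theorem FanRefines.of_initialIdealExtends {F : W → Weighting A ι k} {R R' : Subring A} {h : R ≤ R'}
    (H : ∀ w, InitialIdealExtends (F w) R R' h) : FanRefines F R R' h := by
  rintro I _ ⟨w₀, rfl⟩ w ⟨w₁, h₁, h₁'⟩
  refine ⟨_, ⟨w₁, rfl⟩, ?_⟩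
  rintro w₂ ⟨h₂, h₂'⟩
  have hcoeff := h₂.2.trans h₁.2.symm
  obtain ⟨e₁, he₁⟩ := h₁'
  obtain ⟨e₂, he₂⟩ := h₂'
  -- Any point `w₁` of the intersection can serve as base point of the target cone. For another
  -- point `w₂`, passing through the graded ring at `w` identifies the graded rings of `R'` at `w₁`
  -- and `w₂`.
  have he : ∀ s, ((F w₂).restrict R').grCoeff ((e₁.symm.trans e₂) s) =
      ((F w₁).restrict R').grCoeff s := fun s => by
    rw [RingEquiv.trans_apply, he₂, ← he₁, RingEquiv.apply_symm_apply]
  refine ⟨⟨_, he⟩, ?_⟩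
  set e := e₁.symm.trans e₂ with hedef
  -- The two initial ideals over `R` have the same coefficients, and both `e` and the inclusions
  -- preserve coefficients; injectivity of `grCoeff` then gives equality inside the graded ring of
  -- `R'`. By hypothesis these images generate the initial ideals of the extension.
  have himage : e '' (((F w₁).grInclusion h) '' (((F w₁).restrict R).initialIdeal I)) =
      ((F w₂).grInclusion h) '' (((F w₂).restrict R).initialIdeal I) := by
    refine (Weighting.grCoeff_injective ((F w₂).restrict R')).image_injective ?_
    simp only [Set.image_image, he, Weighting.grCoeff_grInclusion]
    exact hcoeff.symm
  have hideal : Ideal.map (e : ((F w₁).restrict R').Gr →+* ((F w₂).restrict R').Gr)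
      (((F w₁).restrict R').initialIdeal (Ideal.map (Subring.inclusion h) I)) =
        ((F w₂).restrict R').initialIdeal (Ideal.map (Subring.inclusion h) I) := by
    rw [← H w₁ I, ← H w₂ I]
    exact (Ideal.map_span (e : ((F w₁).restrict R').Gr →+* ((F w₂).restrict R').Gr) _).trans
      (congrArg Ideal.span himage)
  rw [← hideal]
  have hset : ((Ideal.map (e : ((F w₁).restrict R').Gr →+* ((F w₂).restrict R').Gr)
      (((F w₁).restrict R').initialIdeal (Ideal.map (Subring.inclusion h) I)) :
        Ideal ((F w₂).restrict R').Gr) : Set ((F w₂).restrict R').Gr) =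
      e '' (((F w₁).restrict R').initialIdeal (Ideal.map (Subring.inclusion h) I)) := by
    ext s
    exact Ideal.mem_map_iff_of_surjective
      (e : ((F w₁).restrict R').Gr →+* ((F w₂).restrict R').Gr) e.surjective
  rw [hset, Set.image_image]
  simp only [he]

end extension
-- Transferring order bounds along flat extensions.
section transfer

variable {k : Type*} [Field k] {n : ℕ}

theorem pairing_le_of_le {u : Fin n → ℝ} (hu : ∀ i, u i ≤ 0) {α β : Fin n →₀ ℕ} (h : β ≤ α) :
    pairing u α ≤ pairing u β :=
  Finset.sum_le_sum fun i _ => mul_le_mul_of_nonpos_left (by exact_mod_cast h i) (hu i)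

theorem pairing_nonpos {u : Fin n → ℝ} (hu : ∀ i, u i ≤ 0) (α : Fin n →₀ ℕ) : pairing u α ≤ 0 :=
  Finset.sum_nonpos fun i _ => mul_nonpos_of_nonpos_of_nonneg (hu i) (Nat.cast_nonneg _)

/-- Suppose that the combination `∑ j, a j * P j` of vectors over `R` with coefficients in `R'`
satisfies bounds on the orders of its entries. Then it is a combination, with coefficients in `R'`,
of combinations of the `P j` over `R` which satisfy the same bounds. -/
theorem LinearlyFlat.exists_bounded_combination {R R' : Subring (MvPowerSeries (Fin n) k)}
    (hflat : LinearlyFlat R R') (hR : polynomialRing k n ≤ R) (hRR' : R ≤ R')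
    (hd : HasMonomialDivision R')
    {u : Fin n → ℝ} (hu : ∀ i, u i ≤ 0) {J V : Type} [Fintype J] [Fintype V]
    {P : J → V → MvPowerSeries (Fin n) k} (hP : ∀ j v, P j v ∈ R)
    {a : J → MvPowerSeries (Fin n) k} (ha : ∀ j, a j ∈ R') {t : V → ℝ}
    (h : ∀ v α, MvPowerSeries.coeff α (∑ j, a j * P j v) ≠ 0 → pairing u α ≤ t v) :
    ∃ (L : ℕ) (c : Fin L → MvPowerSeries (Fin n) k) (s : Fin L → J → MvPowerSeries (Fin n) k),
      (∀ l, c l ∈ R') ∧ (∀ l j, s l j ∈ R) ∧ (∀ j, a j = ∑ l, c l * s l j) ∧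
      ∀ l v α, MvPowerSeries.coeff α (∑ j, s l j * P j v) ≠ 0 → pairing u α ≤ t v := by
  classical
  -- As `u ≤ 0`, this set is closed under passing to multiples of monomials, so the bound on entry
  -- `v` is membership in the monomial ideal generated by `B v`.
  choose B hB hB' using fun v => exists_finset_le {α : Fin n →₀ ℕ | pairing u α ≤ t v}
  choose d hdR' hPd using fun v => hd (B v) (∑ j, a j * P j v)
    (Subring.sum_mem _ fun j _ => R'.mul_mem (ha j) (hRR' (hP j v)))
    fun α hα => hB' v α (h v α hα)
  -- Row `v` is the equation `∑ P_jv y_j = ∑ x^b y_(v,b)` over `b ∈ B v`. Its solutions encode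
  -- combinations of the `P j` that satisfy the order bounds, so splitting `(a, d)` into solutions
  -- over `R` preserves those bounds.
  let M : V → J ⊕ (Σ v, B v) → MvPowerSeries (Fin n) k := fun v =>
    Sum.elim (fun j => P j v) fun p => if p.1 = v then -MvPowerSeries.monomial p.2.1 1 else 0
  have hM : ∀ v (y : J ⊕ (Σ v, B v) → MvPowerSeries (Fin n) k),
      ∑ o, M v o * y o = ∑ j, P j v * y (.inl j) -
        ∑ b : B v, MvPowerSeries.monomial b.1 1 * y (.inr ⟨v, b⟩) := fun v y => by
    rw [Fintype.sum_sum_type, Fintype.sum_sigma, Finset.sum_eq_single v, sub_eq_add_neg,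
      ← Finset.sum_neg_distrib]
    · simp [M]
    · intro v' _ hv'
      simp [M, hv']
    · simp
  obtain ⟨L, c, s, hc, hs, hMs, hys⟩ := hflat V (J ⊕ (Σ v, B v)) M
    (fun v o => by
      rcases o with j | p
      · exact hP j v
      · simp only [M, Sum.elim_inr]
        split_ifs
        · exact R.neg_mem (hR (monomial_mem_polynomialRing _ _))
        · exact R.zero_mem)
    (Sum.elim a fun p => d p.1 p.2)
    (fun o => by
      rcases o with j | p
      · exact ha j
      · exact hdR' _ _)
    fun v => by
      rw [hM, sub_eq_zero]
      simp only [Sum.elim_inl, Sum.elim_inr, mul_comm (P _ v)]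
      rw [hPd, ← Finset.sum_coe_sort]
      simp only [mul_comm]
  refine ⟨L, c, fun l j => s l (.inl j), hc, fun l j => hs l _, fun j => hys (.inl j),
    fun l v α hα => ?_⟩
  have h1 := hMs l v
  rw [hM, sub_eq_zero] at h1
  simp only [mul_comm (P _ v)] at h1
  rw [h1, map_sum] at hα
  obtain ⟨b, -, hb⟩ := Finset.exists_ne_zero_of_sum_ne_zero hα
  rw [MvPowerSeries.coeff_monomial_mul] at hb
  split_ifs at hb with hle
  · exact (pairing_le_of_le hu hle).trans (hB v b.2)
  · exact absurd rfl hb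

/-- Over a linearly flat extension of rings of power series, initial ideals extend. -/
theorem LinearlyFlat.initialIdealExtends_series {R R' : Subring (MvPowerSeries (Fin n) k)}
    (hflat : LinearlyFlat R R') (hR : polynomialRing k n ≤ R) (hRR' : R ≤ R')
    (hd : HasMonomialDivision R') (u : Uloc n) :
    InitialIdealExtends (seriesOrder k u) R R' hRR' := by
  refine .of_closure fun I t P hP hPt => ?_
  obtain ⟨r, a, g, rfl⟩ := Submodule.mem_span_set'.1 hP
  choose g' hg' hgg' using fun j => (g j).2
  have hsum : ((∑ j, a j • (g j : R') : R') : MvPowerSeries (Fin n) k) =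
      ∑ j, (a j : MvPowerSeries (Fin n) k) * (g' j : MvPowerSeries (Fin n) k) := by
    push_cast
    refine Finset.sum_congr rfl fun j _ => ?_
    rw [← hgg' j]
    rfl
  rw [hsum] at hPt ⊢
  obtain ⟨L, c, s, hc, hs, has, hst⟩ := hflat.exists_bounded_combination hR hRR' hd u.2
    (P := fun j (_ : Unit) => (g' j : MvPowerSeries (Fin n) k)) (fun j _ => (g' j).2)
    (fun j => (a j).2) (t := fun _ => t) fun _ α hα => hPt α hα
  have key : ∑ j, (a j : MvPowerSeries (Fin n) k) * (g' j : MvPowerSeries (Fin n) k) =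
      ∑ l, c l * ∑ j, s l j * (g' j : MvPowerSeries (Fin n) k) := by
    simp only [has, Finset.sum_mul, Finset.mul_sum]
    rw [Finset.sum_comm]
    simp only [mul_assoc]
  rw [key]
  refine AddSubgroup.sum_mem _ fun l _ => AddSubgroup.subset_closure
    ⟨c l, hc l, fun α _ => pairing_nonpos u.2 α, ∑ j, (⟨s l j, hs l j⟩ : R) * g' j,
      Ideal.sum_mem _ fun j _ => I.mul_mem_left _ (hg' j), ?_, ?_⟩
  · push_cast
    exact fun α hα => hst l () α hα
  · push_cast
    rfl

/-! ### Differential operators as vectors of power series. -/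

namespace DiffOp

theorem term_zero_mul (c : MvPowerSeries (Fin n) k) (P : DiffOp k n) : term 0 c * P = c • P := by
  rw [mul_def, leftMul_term, monomialMul_zero]
  rfl

theorem eq_sum_term (P : DiffOp k n) {T : Finset (Fin n →₀ ℕ)} (hT : ∀ β ∉ T, P.coeffAt β = 0) :
    P = ∑ β ∈ T, term 0 (P.coeffAt β) * term β 1 := by
  simp only [term_zero_mul, smul_term, mul_one]
  have h := (Finsupp.sum_single (M := MvPowerSeries (Fin n) k) P).symm
  refine h.trans (Finset.sum_subset (fun β hβ => ?_) fun β _ hβ => ?_)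
  · by_contra hβT
    exact Finsupp.mem_support_iff.1 hβ (hT β hβT)
  · have : P.coeffAt β = 0 := Finsupp.notMem_support_iff.1 hβ
    change term β (P.coeffAt β) = 0
    rw [this, map_zero]

theorem exists_support {J : Type*} [Fintype J] (P : J → DiffOp k n) :
    ∃ T : Finset (Fin n →₀ ℕ), ∀ j, ∀ β ∉ T, (P j).coeffAt β = 0 := by
  classical
  refine ⟨Finset.univ.biUnion fun j =>
    Finsupp.support (M := MvPowerSeries (Fin n) k) (P j), fun j β hβ => ?_⟩
  by_contra h
  exact hβ (Finset.mem_biUnion.2 ⟨j, Finset.mem_univ j, Finsupp.mem_support_iff.2 h⟩)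

/-- Taking a coefficient, as a linear map. -/
def coeffLinear (β : Fin n →₀ ℕ) : DiffOp k n →ₗ[MvPowerSeries (Fin n) k] MvPowerSeries (Fin n) k where
  toFun P := P.coeffAt β
  map_add' _ _ := rfl
  map_smul' _ _ := rfl

/-- Multiplication by a series on the left involves no derivatives. Combinations with series as left
coefficients are thus ordinary linear algebra on vectors of coefficients, to which flatness applies.
-/
theorem coeffAt_sum_term_mul {J : Type*} [Fintype J] (a : J → MvPowerSeries (Fin n) k)
    (P : J → DiffOp k n) (β : Fin n →₀ ℕ) :
    (∑ j, term 0 (a j) * P j).coeffAt β = ∑ j, a j * (P j).coeffAt β := by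
  simp only [term_zero_mul]
  exact (map_sum (coeffLinear β) _ _)

theorem coeffAt_term (β γ : Fin n →₀ ℕ) [Decidable (β = γ)] (c : MvPowerSeries (Fin n) k) :
    (term β c).coeffAt γ = if β = γ then c else 0 :=
  Finsupp.single_apply

theorem term_mem_withCoeffs {S : Subring (MvPowerSeries (Fin n) k)}
    (hS : ∀ i, ∀ f ∈ S, MvPowerSeries.pderiv k i f ∈ S) (β : Fin n →₀ ℕ)
    {c : MvPowerSeries (Fin n) k} (hc : c ∈ S) : term β c ∈ withCoeffs S hS := fun γ => by
  classical
  rw [coeffAt_term]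
  split_ifs
  exacts [hc, S.zero_mem]

/-- The extension of a left ideal from a ring of differential operators to a bigger one is spanned
by the ideal over the bigger ring of coefficients. -/
theorem exists_eq_sum_of_mem_map {R R' : Subring (MvPowerSeries (Fin n) k)}
    (hR : ∀ i, ∀ f ∈ R, MvPowerSeries.pderiv k i f ∈ R) {D' : Subring (DiffOp k n)}
    (hD' : ∀ P ∈ D', ∀ β, P.coeffAt β ∈ R') (h : withCoeffs R hR ≤ D')
    (I : Ideal (withCoeffs R hR)) {P : D'} (hP : P ∈ Ideal.map (Subring.inclusion h) I) :
    ∃ (J : Type) (_ : Fintype J) (a : J → MvPowerSeries (Fin n) k) (g : J → withCoeffs R hR),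
      (∀ j, a j ∈ R') ∧ (∀ j, g j ∈ I) ∧
      (P : DiffOp k n) = ∑ j, term 0 (a j) * (g j : DiffOp k n) := by
  obtain ⟨r, a, g, rfl⟩ := Submodule.mem_span_set'.1 hP
  choose g' hg' hgg' using fun j => (g j).2
  obtain ⟨T, hT⟩ := exists_support fun j => (a j : DiffOp k n)
  -- Each multiplier is expanded as `∑ c_β ∂^β`, and `∂^β` is moved into the generator: `∂^β g`
  -- stays in the left ideal `I`, as `∂^β` already has coefficients in `R`.
  refine ⟨Fin r × T, inferInstance, fun p => (a p.1 : DiffOp k n).coeffAt p.2,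
    fun p => ⟨term p.2 1, term_mem_withCoeffs hR p.2 R.one_mem⟩ * g' p.1,
    fun p => hD' _ (a p.1).2 _, fun p => I.mul_mem_left _ (hg' p.1), ?_⟩
  push_cast
  rw [Fintype.sum_prod_type]
  refine Finset.sum_congr rfl fun j _ => ?_
  simp only [← mul_assoc, ← Finset.sum_mul]
  rw [← hgg' j, Finset.sum_coe_sort T fun β =>
    term 0 ((a j : DiffOp k n).coeffAt β) * (term β 1 : DiffOp k n), ← eq_sum_term _ (hT j)]
  rfl

end DiffOp

open DiffOp in
/-- Over a linearly flat extension of the rings of coefficients, initial ideals of left ideals of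
differential operators extend. -/
theorem LinearlyFlat.initialIdealExtends_operators {R R' : Subring (MvPowerSeries (Fin n) k)}
    (hflat : LinearlyFlat R R') (hR : polynomialRing k n ≤ R) (hRR' : R ≤ R')
    (hd : HasMonomialDivision R') (hder : ∀ i, ∀ f ∈ R, MvPowerSeries.pderiv k i f ∈ R)
    {D' : Subring (DiffOp k n)} (hD' : ∀ P, P ∈ D' ↔ ∀ β, P.coeffAt β ∈ R')
    (h : withCoeffs R hder ≤ D') (w : Wloc n) :
    InitialIdealExtends (operatorOrder k w) (withCoeffs R hder) D' h := by
  classical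
  refine .of_closure fun I t P hP hPt => ?_
  obtain ⟨J, _, a, g, ha, hg, hPg⟩ := exists_eq_sum_of_mem_map hder (fun P => (hD' P).1) h I hP
  rw [hPg] at hPt ⊢
  obtain ⟨T, hT⟩ := exists_support fun j => (g j : DiffOp k n)
  -- Order at most `t` for `w = (u, v)` means that the coefficient series of each `∂^β` satisfies
  -- the bound `t - v · β` for `u`. Only the finitely many `β` in the common support `T` matter.
  obtain ⟨L, c, s, hc, hs, has, hst⟩ := hflat.exists_bounded_combination hR hRR' hd
    (fun i => (w.2 i).1) (P := fun j (β : T) => (g j : DiffOp k n).coeffAt β)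
    (fun j β => (g j).2 β) ha (t := fun β => t - pairing w.1.2 β) fun β α hα => by
      rw [← coeffAt_sum_term_mul] at hα
      exact le_sub_iff_add_le.2 (hPt (α, β) hα)
  have key : ∑ j, term 0 (a j) * (g j : DiffOp k n) =
      ∑ l, term 0 (c l) * ∑ j, term 0 (s l j) * (g j : DiffOp k n) := by
    simp only [has, map_sum, Finset.sum_mul, Finset.mul_sum, term_zero_mul, ← mul_smul]
    rw [Finset.sum_comm]
  rw [key]
  refine AddSubgroup.sum_mem _ fun l _ => AddSubgroup.subset_closure
    ⟨term 0 (c l), (hD' _).2 fun β => ?_, fun p hp => ?_,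
      ∑ j, (⟨term 0 (s l j), term_mem_withCoeffs hder 0 (hs l j)⟩ : withCoeffs R hder) * g j,
      Ideal.sum_mem _ fun j _ => I.mul_mem_left _ (hg j), ?_, ?_⟩
  · rw [coeffAt_term]
    split_ifs
    exacts [hc l, R'.zero_mem]
  · change MvPowerSeries.coeff p.1 ((term 0 (c l)).coeffAt p.2) ≠ 0 at hp
    rw [coeffAt_term] at hp
    split_ifs at hp with h0
    · change pairing w.1.1 p.1 + pairing w.1.2 p.2 ≤ 0
      rw [← h0, show pairing w.1.2 0 = 0 by simp [pairing], add_zero]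
      exact pairing_nonpos (fun i => (w.2 i).1) _
    · exact absurd (map_zero _) hp
  · push_cast
    intro p hp
    change MvPowerSeries.coeff p.1 ((∑ j, term 0 (s l j) * (g j : DiffOp k n)).coeffAt p.2) ≠ 0 at hp
    rw [coeffAt_sum_term_mul] at hp
    by_cases hpT : p.2 ∈ T
    · exact le_sub_iff_add_le.1 (hst l ⟨p.2, hpT⟩ p.1 hp)
    · simp [hT _ _ hpT] at hp
  · push_cast
    rfl

end transfer
end GrobnerComparison

/-! ### Assembly: each pair of rings with its flatness and monomial division. -/

theorem mainTheorem8 (k : Type*) [Field k] (n : ℕ) :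
    -- power series rings, local weights `u`
    (∀ u : Uloc n,
      InitialIdealExtends (seriesOrder k u) (polynomialRing k n) (localRing k n)
        polynomialRing_le_localRing ∧
      InitialIdealExtends (seriesOrder k u) (localRing k n) ⊤ le_top ∧
      InitialIdealExtends (seriesOrder ℂ u) (localRing ℂ n) (analyticRing n)
        localRing_le_analyticRing ∧
      InitialIdealExtends (seriesOrder ℂ u) (analyticRing n) ⊤ le_top) ∧
    -- rings of differential operators, local weights `w = (u, v)`
    (∀ w : Wloc n,
      InitialIdealExtends (operatorOrder k w) (DiffOp.polynomial k n) (DiffOp.algebraic k n)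
        DiffOp.polynomial_le_algebraic ∧
      InitialIdealExtends (operatorOrder k w) (DiffOp.algebraic k n) ⊤ le_top ∧
      InitialIdealExtends (operatorOrder ℂ w) (DiffOp.algebraic ℂ n) (DiffOp.analytic n)
        DiffOp.algebraic_le_analytic ∧
      InitialIdealExtends (operatorOrder ℂ w) (DiffOp.analytic n) ⊤ le_top) ∧
    -- the global open fan, cut along the strata of the local ring, refines the local open fan
    FanRefines (fun u : Uloc n => seriesOrder k u) (polynomialRing k n) (localRing k n)
      polynomialRing_le_localRing ∧
    FanRefines (fun w : Wloc n => operatorOrder k w) (DiffOp.polynomial k n)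
      (DiffOp.algebraic k n) DiffOp.polynomial_le_algebraic := by
  have hs (u : Uloc n) : InitialIdealExtends (seriesOrder k u) (polynomialRing k n) (localRing k n)
      polynomialRing_le_localRing :=
    linearlyFlat_polynomialRing_localRing.initialIdealExtends_series le_rfl _
      hasMonomialDivision_localRing u
  have ho (w : Wloc n) : InitialIdealExtends (operatorOrder k w) (DiffOp.polynomial k n)
      (DiffOp.algebraic k n) DiffOp.polynomial_le_algebraic :=
    linearlyFlat_polynomialRing_localRing.initialIdealExtends_operators le_rfl
      polynomialRing_le_localRing hasMonomialDivision_localRing _ (fun _ => Iff.rfl) _ w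
  refine ⟨fun u => ⟨hs u, ?_, ?_, ?_⟩, fun w => ⟨ho w, ?_, ?_, ?_⟩,
    .of_initialIdealExtends hs, .of_initialIdealExtends ho⟩
  · exact linearlyFlat_localRing_top.initialIdealExtends_series polynomialRing_le_localRing _
      hasMonomialDivision_top u
  · exact linearlyFlat_localRing_analyticRing.initialIdealExtends_series
      polynomialRing_le_localRing _ hasMonomialDivision_analyticRing u
  · exact linearlyFlat_analyticRing_top.initialIdealExtends_series
      polynomialRing_le_analyticRing _ hasMonomialDivision_top u
  · exact linearlyFlat_localRing_top.initialIdealExtends_operators polynomialRing_le_localRing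
      le_top hasMonomialDivision_top _ (fun _ => by simp) _ w
  · exact linearlyFlat_localRing_analyticRing.initialIdealExtends_operators
      polynomialRing_le_localRing localRing_le_analyticRing hasMonomialDivision_analyticRing _
      (fun _ => Iff.rfl) _ w
  · exact linearlyFlat_analyticRing_top.initialIdealExtends_operators
      polynomialRing_le_analyticRing le_top hasMonomialDivision_top _ (fun _ => by simp) _ w
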